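/- **Definitions.** A *linear 3-periodic net* in $\mathbb R^3$ is a pair $(N,S)$, where $S$ is a countable set of nondegenerate line segments (edges) $[p,q]$, distinct edges meeting at most in a common endpoint, $N$ (the nodes) is the set of endpoints of the edges, and there is a *periodicity basis*: a basis $\underline a$ of $\mathbb R^3$ such that $N$ and $S$ are invariant under the translation group generated by $\underline a$ and consist of finitely many orbits of it. The body $|\mathcal N|$ of a net $\mathcal N$ is the union of its edges. Let $\mathcal M_{\rm pcu}$ be the net with node set $\mathbb Z^3$ whose edges are the segments $[x,x+e_i]$ with $x\in\mathbb Z^3$, $i=1,2,3$, where $e_1,e_2,e_3$ is the standard basis. An *$m$-grid* is a linear 3-periodic net which is the union of $m$ pairwise disjoint parallel components, each a translate of one and the same scaled and rotated copy of $\mathcal M_{\rm pcu}$. For $n\ge 0$, a *framed $n$-grid* is an $(n+1)$-grid with one distinguished component, whose nodes are given one colour while all the other nodes are given a second colour. Two nets $\mathcal N_0,\mathcal N_1$ with coloured nodes are *periodically isotopic, respecting colour,* if there are linear 3-periodic nets $\mathcal N_t$ with coloured nodes ($0\le t\le 1$, with the given $\mathcal N_0$ and $\mathcal N_1$ at the ends),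 a continuous path $t\mapsto\underline a^t$ of right-handed periodicity bases $\underline a^t$ for $\mathcal N_t$, and bijections $f_t:|\mathcal N_0|\to|\mathcal N_t|$ which map nodes to nodes of the same colour and map each edge $[p,q]$ affinely onto the edge $[f_t(p),f_t(q)]$ of $\mathcal N_t$, such that $f_0$ is the identity and $t\mapsto f_t(p)$ is continuous for each node $p$ of $\mathcal N_0$. A *pattern* is a set of $n$ points of $\{1,\dots,n\}^3$ any two different points of which differ in each of the three coordinates. The group $R$ of the 24 rotations of the cube acts on $\{1,\dots,n\}^3$, by rotation about the centre of this array, and so acts on the set of patterns. Let $\rho(n)$ be the number of orbits of $R$ on the set of patterns. **Theorem 7.5 (framed $n$-grids).** For every integer $n\ge 0$, periodic isotopy respecting colour is an equivalence relation on the set of framed $n$-grids, and the number of its equivalence classes is $\rho(n)$. -/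

import Mathlib

open Set

noncomputable section

namespace FramedGrids

/-- Euclidean 3-space. -/
abbrev E3 : Type := EuclideanSpace ℝ (Fin 3)

/-! ### Linear 3-periodic nets -/

/-- The line segment `[p, q]` determined by an unordered pair of end points. -/
def seg (e : Sym2 E3) : Set E3 :=
  Sym2.lift ⟨fun p q => segment ℝ p q, fun p q => segment_symm ℝ p q⟩ e

/-- The union of the line segments of a set of edges. -/
def bodyOf (S : Set (Sym2 E3)) : Set E3 := ⋃ e ∈ S, seg e

/-- The group of translation vectors generated by a triple of vectors. -/
def translations (a : Fin 3 → E3) : AddSubgroup E3 :=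
  AddSubgroup.closure (Set.range a)

/-- `a` is a periodicity basis for the nodes `N` and edges `S`: it is a basis of space, `N` and `S`
are invariant under the translation group it generates, and they consist of finitely many
translation orbits. -/
structure IsPeriodicityBasis (N : Set E3) (S : Set (Sym2 E3)) (a : Fin 3 → E3) : Prop where
  linearIndependent : LinearIndependent ℝ a
  nodes_invariant : ∀ v ∈ translations a, ∀ x ∈ N, x + v ∈ N
  edges_invariant : ∀ v ∈ translations a, ∀ e ∈ S, e.map (fun x => x + v) ∈ S
  nodes_finite : ∃ F : Set E3, F.Finite ∧ F ⊆ N ∧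
    ∀ x ∈ N, ∃ y ∈ F, ∃ v ∈ translations a, x = y + v
  edges_finite : ∃ F : Set (Sym2 E3), F.Finite ∧ F ⊆ S ∧
    ∀ e ∈ S, ∃ d ∈ F, ∃ v ∈ translations a, e = d.map (fun x => x + v)

/-- A triple of vectors is right-handed if its determinant is positive. -/
def RightHanded (a : Fin 3 → E3) : Prop :=
  0 < (Matrix.of fun i j : Fin 3 => a i j).det

/-- A (proper) linear 3-periodic net. An edge is a nondegenerate line segment, recorded by its
unordered pair of end points. Distinct edges are essentially disjoint: they meet at most in a
common end point. -/
structure Net where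
  nodes : Set E3
  edges : Set (Sym2 E3)
  countable : edges.Countable
  nondegenerate : ∀ e ∈ edges, ¬ e.IsDiag
  noncrossing : ∀ e ∈ edges, ∀ d ∈ edges, e ≠ d → ∀ x, x ∈ seg e → x ∈ seg d → x ∈ e ∧ x ∈ d
  nodes_eq : nodes = {x | ∃ e ∈ edges, x ∈ e}
  periodic : ∃ a, IsPeriodicityBasis nodes edges a

/-- The body of a net. -/
def Net.body (N : Net) : Set E3 := bodyOf N.edges

/-- A net whose nodes are coloured with two colours; `frame` is the set of nodes of the
distinguished colour. -/
structure ColouredNet extends Net where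
  frame : Set E3
  frame_subset : frame ⊆ nodes

/-! ### Periodic isotopy -/

/-- Colour-preserving periodic isotopy: there are (noncrossing) coloured nets `N t`, with
`N 0 = N₀` and `N 1 = N₁`, a continuous path of right-handed periodicity bases `a t` for `N t`, and
bijections `f t` from the body of `N₀` to that of `N t`, taking nodes to nodes of the same colour
and each edge affinely onto an edge, such that `f 0` is the identity and every node moves
continuously. (The values of `f t` outside the body of `N₀` play no role.) -/
def PeriodicallyIsotopic (N₀ N₁ : ColouredNet) : Prop :=
  ∃ (N : unitInterval → ColouredNet) (a : unitInterval → Fin 3 → E3)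
    (f : unitInterval → E3 → E3),
    N 0 = N₀ ∧ N 1 = N₁ ∧
    Continuous a ∧
    (∀ t, IsPeriodicityBasis (N t).nodes (N t).edges (a t) ∧ RightHanded (a t)) ∧
    (∀ t, BijOn (f t) N₀.body (N t).body) ∧
    (∀ t, MapsTo (f t) N₀.nodes (N t).nodes) ∧
    (∀ t, ∀ p ∈ N₀.nodes, f t p ∈ (N t).frame ↔ p ∈ N₀.frame) ∧
    (∀ x ∈ N₀.body, f 0 x = x) ∧
    (∀ p ∈ N₀.nodes, Continuous fun t => f t p) ∧
    (∀ t, ∀ p q : E3, s(p, q) ∈ N₀.edges →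
      s(f t p, f t q) ∈ (N t).edges ∧
      ∀ r ∈ Icc (0 : ℝ) 1,
        f t (AffineMap.lineMap p q r) = AffineMap.lineMap (f t p) (f t q) r)

/-! ### Grids -/

/-- The nodes of the model primitive cubic net: the integer lattice. -/
def pcuNodes : Set E3 := {x | ∀ i, ∃ k : ℤ, x i = k}

/-- The edges of the model primitive cubic net: the unit axial segments between lattice points. -/
def pcuEdges : Set (Sym2 E3) :=
  {e | ∃ x ∈ pcuNodes, ∃ i : Fin 3, e = s(x, x + EuclideanSpace.single i (1 : ℝ))}

/-- The similarity of space with scaling factor `c`, linear isometry `Q` and shift vector `p`. -/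
def similarity (c : ℝ) (Q : E3 ≃ₗᵢ[ℝ] E3) (p : E3) : E3 → E3 := fun x => p + c • Q x

/-- `N` is an `(n+1)`-grid with one distinguished component: it is the union of `n+1` pairwise
disjoint parallel components, which are translates of one scaled and rotated copy of the model
primitive cubic net (the same scaling and rotation for all of them), and the nodes of the
distinguished colour are those of exactly one component. The components are labelled so that the
distinguished one has label `0`. -/
def IsFramedGrid (n : ℕ) (N : ColouredNet) : Prop :=
  ∃ (c : ℝ) (Q : E3 ≃ₗᵢ[ℝ] E3) (p : Fin (n + 1) → E3), 0 < c ∧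
    N.nodes = ⋃ i, similarity c Q (p i) '' pcuNodes ∧
    N.edges = ⋃ i, Sym2.map (similarity c Q (p i)) '' pcuEdges ∧
    (∀ i j, i ≠ j → Disjoint (bodyOf (Sym2.map (similarity c Q (p i)) '' pcuEdges))
      (bodyOf (Sym2.map (similarity c Q (p j)) '' pcuEdges))) ∧
    N.frame = similarity c Q (p 0) '' pcuNodes

/-- Framed `n`-grids. -/
def FramedGrid (n : ℕ) : Type := {N : ColouredNet // IsFramedGrid n N}

/-- Colour-preserving periodic isotopy of framed `n`-grids. The intermediate nets need not be
grids. -/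
def FramedGrid.Isotopic {n : ℕ} (M M' : FramedGrid n) : Prop :=
  PeriodicallyIsotopic M.1 M'.1

/-! ### Patterns and cube rotations -/

/-- Patterns: sets of `n` points of the discrete torus `{0, …, n-1}³` no two of which agree in any
coordinate. -/
def Pattern (n : ℕ) : Type :=
  {P : Finset (Fin 3 → Fin n) // P.card = n ∧ ∀ p ∈ P, ∀ q ∈ P, p ≠ q → ∀ i, p i ≠ q i}

/-- The position of a point of `{0, …, n-1}³` relative to the centre of the cube, in units of half
the grid spacing. -/
def centred (n : ℕ) (p : Fin 3 → Fin n) : Fin 3 → ℤ := fun i => 2 * (p i : ℤ) + 1 - n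

/-- Two patterns are in the same orbit if a rotation of the cube about its centre takes one to the
other. The rotation group of the cube is the group of orthogonal integer matrices of determinant
one. -/
def SameOrbit {n : ℕ} (P P' : Pattern n) : Prop :=
  ∃ g ∈ Matrix.specialOrthogonalGroup (Fin 3) ℤ,
    centred n '' (P'.1 : Set (Fin 3 → Fin n)) =
      (fun v => g.mulVec v) '' (centred n '' (P.1 : Set (Fin 3 → Fin n)))

theorem sameOrbit_equivalence (n : ℕ) : Equivalence (SameOrbit (n := n)) where
  refl P := ⟨1, one_mem _, by simp⟩
  symm := by
    rintro P P' ⟨g, hg, h⟩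
    have hg' := hg
    rw [Matrix.mem_specialOrthogonalGroup_iff, Matrix.mem_orthogonalGroup_iff'] at hg'
    have h1 : g.transpose * g = 1 := hg'.1
    refine ⟨g.transpose, ?_, ?_⟩
    · rw [Matrix.mem_specialOrthogonalGroup_iff, Matrix.mem_orthogonalGroup_iff]
      refine ⟨?_, by rw [Matrix.det_transpose]; exact hg'.2⟩
      change g.transpose * g.transpose.transpose = 1
      rw [Matrix.transpose_transpose, h1]
    · rw [h, Set.image_image]
      simp [Matrix.mulVec_mulVec, h1]
  trans := by
    rintro P P' P'' ⟨g, hg, h⟩ ⟨g', hg', h'⟩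
    refine ⟨g' * g, mul_mem hg' hg, ?_⟩
    rw [h', h, Set.image_image]
    simp [Matrix.mulVec_mulVec]

/-- The orbit relation of the cube rotation group on patterns. -/
def orbitSetoid (n : ℕ) : Setoid (Pattern n) := ⟨SameOrbit, sameOrbit_equivalence n⟩

/-- The number of orbits of the cube rotation group on patterns. -/
def rho (n : ℕ) : ℕ := Nat.card (Quotient (orbitSetoid n))

end FramedGrids

end

noncomputable section

namespace FramedGrids

/-! ### The Poincaré–Miranda theorem in dimension three -/

/-! A framed grid is described by a right-handed basis `b` and shift vectors `u i` in coordinates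
with respect to `b`, the distinguished component having label 0. Its components are disjoint exactly
when no coordinate difference `u i k - u j k` with `i ≠ j` is an integer (`Admissible`). The theorem
says that up to isotopy only the integer parts of these differences matter (`SameCell`), apart from
the freedom to relabel components, change shifts by integer vectors and rotate the cube
(`ShiftEquiv`).

If two shift families lie in the same cell, the straight path between them stays admissible, and
right-handed bases can be joined by a path (`exists_path_det_pos`); together these give an isotopy
through affine images of grids (`isotopic_of_sameCell`).

The converse `shiftEquiv_of_isotopic` must deal with arbitrary intermediate nets. Some multiple of
`b` consists of periods, so `b` moves continuously along with the periodicity bases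
(`exists_moving_basis`). A node translated by such a period is again a node, and its label cannot
jump, because an interval is not a countable disjoint union of two or more nonempty closed sets
(`NodeMotion.equivariant`). Hence, in moving coordinates, the nodes stay within bounded distance of
their lattice positions. Suppose now that `⌊u i c - u j c⌋` changed. Then a line of component `i`
and a line of component `j`, in the two directions other than `c`, would have exchanged their
heights while staying close to their axes; by the Poincaré–Miranda theorem they would have met at
some time (`NodeMotion.sub_le_of_sub_lt`), which noncrossing forbids. At the end of the isotopy, the
graph structure and periodicity force the nodes to move affinely on each component
(`NodeMotion.affine_endpoint`), and the linear part is a rotation of the cube.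

Finally, the cell modulo relabelling and integer shifts is recorded by the order, in each
coordinate, of the fractional parts of the shifts relative to component 0. The ranks in the three
orders form a pattern, every pattern occurs, and cube rotations act on ranks as on patterns
(`centred_cellPoint_realMul`). -/

/-- `F` is constant on the lattice cube with lowest corner `(x, y, z)`. -/
def ConstOnCube (F : ℕ → ℕ → ℕ → ℤ) (x y z : ℕ) : Prop :=
  ∀ a ≤ 1, ∀ b ≤ 1, ∀ c ≤ 1, F (x + a) (y + b) (z + c) = F x y z

theorem ConstOnCube.corners {F : ℕ → ℕ → ℕ → ℤ} {x y z : ℕ} (h : ConstOnCube F x y z) :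
    F (x + 1) y z = F x y z ∧ F x (y + 1) z = F x y z ∧ F x y (z + 1) = F x y z ∧
    F (x + 1) (y + 1) z = F x y z ∧ F (x + 1) y (z + 1) = F x y z ∧
    F x (y + 1) (z + 1) = F x y z ∧ F (x + 1) (y + 1) (z + 1) = F x y z :=
  ⟨h 1 le_rfl 0 zero_le_one 0 zero_le_one, h 0 zero_le_one 1 le_rfl 0 zero_le_one,
    h 0 zero_le_one 0 zero_le_one 1 le_rfl, h 1 le_rfl 1 le_rfl 0 zero_le_one,
    h 1 le_rfl 0 zero_le_one 1 le_rfl, h 0 zero_le_one 1 le_rfl 1 le_rfl,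
    h 1 le_rfl 1 le_rfl 1 le_rfl⟩

/-- A discrete Poincaré–Miranda theorem: it evaluates the cup product of the coboundaries of
`f`, `g`, `h` on the cube by telescoping. -/
theorem exists_cube_not_const (N : ℕ) (f g h : ℕ → ℕ → ℕ → ℤ)
    (f0 : ∀ y ≤ N, ∀ z ≤ N, f 0 y z = 0) (f1 : ∀ y ≤ N, ∀ z ≤ N, f N y z = 1)
    (g0 : ∀ x ≤ N, ∀ z ≤ N, g x 0 z = 0) (g1 : ∀ x ≤ N, ∀ z ≤ N, g x N z = 1)
    (h0 : ∀ x ≤ N, ∀ y ≤ N, h x y 0 = 0) (h1 : ∀ x ≤ N, ∀ y ≤ N, h x y N = 1) :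
    ∃ x < N, ∃ y < N, ∃ z < N,
      ¬ ConstOnCube f x y z ∧ ¬ ConstOnCube g x y z ∧ ¬ ConstOnCube h x y z := by
  by_contra hcon
  push Not at hcon
  let w23 : ℕ → ℕ → ℕ → ℤ := fun x y z =>
    (g x (y+1) z - g x y z) * (h x (y+1) (z+1) - h x (y+1) z)
    - (g x y (z+1) - g x y z) * (h x (y+1) (z+1) - h x y (z+1))
  let w13 : ℕ → ℕ → ℕ → ℤ := fun x y z =>
    (g (x+1) y z - g x y z) * (h (x+1) y (z+1) - h (x+1) y z)
    - (g x y (z+1) - g x y z) * (h (x+1) y (z+1) - h x y (z+1))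
  let w12 : ℕ → ℕ → ℕ → ℤ := fun x y z =>
    (g (x+1) y z - g x y z) * (h (x+1) (y+1) z - h (x+1) y z)
    - (g x (y+1) z - g x y z) * (h (x+1) (y+1) z - h x (y+1) z)
  let R := Finset.range N
  have hω : ∀ x ∈ R, ∀ y ∈ R, ∀ z ∈ R,
      (f (x+1) y z * w23 (x+1) y z - f x y z * w23 x y z)
      - (f x (y+1) z * w13 x (y+1) z - f x y z * w13 x y z)
      + (f x y (z+1) * w12 x y (z+1) - f x y z * w12 x y z) = 0 := by
    intro x hx y hy z hz
    -- The Leibniz rule: `w23`, `w13`, `w12` are the components of the cup product dg ∪ dh, which is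
    -- closed, so the coboundary of f · (dg ∪ dh) is df ∪ dg ∪ dh. The latter vanishes as soon as
    -- one of the three functions is constant on the cube.
    have hid : (f (x+1) y z * w23 (x+1) y z - f x y z * w23 x y z)
      - (f x (y+1) z * w13 x (y+1) z - f x y z * w13 x y z)
      + (f x y (z+1) * w12 x y (z+1) - f x y z * w12 x y z)
      = (f (x+1) y z - f x y z) * w23 (x+1) y z - (f x (y+1) z - f x y z) * w13 x (y+1) z
        + (f x y (z+1) - f x y z) * w12 x y (z+1) := by
      simp only [w23, w13, w12]; ring
    rw [hid]
    have key := hcon x (Finset.mem_range.1 hx) y (Finset.mem_range.1 hy) z (Finset.mem_range.1 hz)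
    by_cases hf : ConstOnCube f x y z
    · obtain ⟨e1, e2, e3, -⟩ := hf.corners
      rw [e1, e2, e3]; ring
    · by_cases hg : ConstOnCube g x y z
      · obtain ⟨e1, e2, e3, e4, e5, e6, e7⟩ := hg.corners
        simp only [w23, w13, w12]
        rw [e1, e2, e3, e4, e5, e6]; ring
      · obtain ⟨e1, e2, e3, e4, e5, e6, e7⟩ := (key hf hg).corners
        simp only [w23, w13, w12]
        rw [e4, e5, e6, e7]; ring
  have hsum : ∑ x ∈ R, ∑ y ∈ R, ∑ z ∈ R,
      ((f (x+1) y z * w23 (x+1) y z - f x y z * w23 x y z)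
      - (f x (y+1) z * w13 x (y+1) z - f x y z * w13 x y z)
      + (f x y (z+1) * w12 x y (z+1) - f x y z * w12 x y z)) = 0 :=
    Finset.sum_eq_zero fun x hx => Finset.sum_eq_zero fun y hy => Finset.sum_eq_zero fun z hz =>
      hω x hx y hy z hz
  simp only [Finset.sum_add_distrib, Finset.sum_sub_distrib] at hsum
  have s1 : ∑ x ∈ R, ∑ y ∈ R, ∑ z ∈ R, f (x+1) y z * w23 (x+1) y z
      - ∑ x ∈ R, ∑ y ∈ R, ∑ z ∈ R, f x y z * w23 x y z = 1 := by
    rw [← Finset.sum_sub_distrib,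
      Finset.sum_range_sub (fun x => ∑ y ∈ R, ∑ z ∈ R, f x y z * w23 x y z)]
    have e0 : ∑ y ∈ R, ∑ z ∈ R, f 0 y z * w23 0 y z = 0 :=
      Finset.sum_eq_zero fun y hy => Finset.sum_eq_zero fun z hz => by
        rw [f0 y (Finset.mem_range.1 hy).le z (Finset.mem_range.1 hz).le, zero_mul]
    -- On this face `f` is 1 and dg ∪ dh is the coboundary of g · dh, so the sum telescopes again,
    -- to the edges of the face. Only the edge where `g` is 1 contributes, namely the total increase
    -- of `h`.
    have e1 : ∑ y ∈ R, ∑ z ∈ R, f N y z * w23 N y z = ∑ y ∈ R, ∑ z ∈ R,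
        ((g N (y+1) z * (h N (y+1) (z+1) - h N (y+1) z) - g N y z * (h N y (z+1) - h N y z))
        - (g N y (z+1) * (h N (y+1) (z+1) - h N y (z+1)) - g N y z * (h N (y+1) z - h N y z))) :=
      Finset.sum_congr rfl fun y hy => Finset.sum_congr rfl fun z hz => by
        rw [f1 y (Finset.mem_range.1 hy).le z (Finset.mem_range.1 hz).le]
        simp only [w23]; ring
    rw [e0, e1]
    simp only [Finset.sum_sub_distrib (s := R)]
    rw [← Finset.sum_sub_distrib]
    simp only [← Finset.sum_sub_distrib]
    have e2 : ∑ y ∈ R, ∑ z ∈ R, (g N (y+1) z * (h N (y+1) (z+1) - h N (y+1) z)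
        - g N y z * (h N y (z+1) - h N y z)) = 1 := by
      rw [Finset.sum_comm]
      have : ∀ z ∈ R, ∑ y ∈ R, (g N (y+1) z * (h N (y+1) (z+1) - h N (y+1) z)
        - g N y z * (h N y (z+1) - h N y z)) = h N N (z+1) - h N N z := fun z hz => by
        rw [Finset.sum_range_sub (fun y => g N y z * (h N y (z+1) - h N y z)),
          g0 N le_rfl z (Finset.mem_range.1 hz).le, g1 N le_rfl z (Finset.mem_range.1 hz).le]
        ring
      rw [Finset.sum_congr rfl this, Finset.sum_range_sub (fun z => h N N z),
        h0 N le_rfl N le_rfl, h1 N le_rfl N le_rfl]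
      rfl
    have e3 : ∑ y ∈ R, ∑ z ∈ R, (g N y (z+1) * (h N (y+1) (z+1) - h N y (z+1))
        - g N y z * (h N (y+1) z - h N y z)) = 0 :=
      Finset.sum_eq_zero fun y hy => by
        have hy' := Finset.mem_range.1 hy
        rw [Finset.sum_range_sub (fun z => g N y z * (h N (y+1) z - h N y z)),
          h0 N le_rfl y hy'.le, h1 N le_rfl y hy'.le, h0 N le_rfl (y+1) hy',
          h1 N le_rfl (y+1) hy']
        ring
    simp only [Finset.sum_sub_distrib (s := R)] at e2 e3 ⊢
    linarith
  -- Each term of `w13` contains a difference of `g` within a face on which `g` is constant; in `s3`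
  -- the same happens with `w12` and `h`.
  have s2 : ∑ x ∈ R, ∑ y ∈ R, ∑ z ∈ R, f x (y+1) z * w13 x (y+1) z
      - ∑ x ∈ R, ∑ y ∈ R, ∑ z ∈ R, f x y z * w13 x y z = 0 := by
    rw [← Finset.sum_sub_distrib]
    refine Finset.sum_eq_zero fun x hx => ?_
    have hx' := Finset.mem_range.1 hx
    rw [← Finset.sum_sub_distrib, Finset.sum_range_sub (fun y => ∑ z ∈ R, f x y z * w13 x y z),
      ← Finset.sum_sub_distrib]
    refine Finset.sum_eq_zero fun z hz => ?_
    have hz' := Finset.mem_range.1 hz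
    simp only [w13]
    rw [g0 x hx'.le z hz'.le, g0 (x+1) hx' z hz'.le, g0 x hx'.le (z+1) hz',
      g1 x hx'.le z hz'.le, g1 (x+1) hx' z hz'.le, g1 x hx'.le (z+1) hz']
    ring
  have s3 : ∑ x ∈ R, ∑ y ∈ R, ∑ z ∈ R, f x y (z+1) * w12 x y (z+1)
      - ∑ x ∈ R, ∑ y ∈ R, ∑ z ∈ R, f x y z * w12 x y z = 0 := by
    rw [← Finset.sum_sub_distrib]
    refine Finset.sum_eq_zero fun x hx => ?_
    rw [← Finset.sum_sub_distrib]
    refine Finset.sum_eq_zero fun y hy => ?_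
    have hx' := Finset.mem_range.1 hx
    have hy' := Finset.mem_range.1 hy
    rw [← Finset.sum_sub_distrib, Finset.sum_range_sub (fun z => f x y z * w12 x y z)]
    simp only [w12]
    rw [h0 (x+1) hx' (y+1) hy', h0 (x+1) hx' y hy'.le, h0 x hx'.le (y+1) hy',
      h1 (x+1) hx' (y+1) hy', h1 (x+1) hx' y hy'.le, h1 x hx'.le (y+1) hy']
    ring
  linarith

/-- If a function with a sign change on a lattice cube is nearly constant there, it is small. -/
theorem abs_le_of_not_constOnCube {F : ℝ × ℝ × ℝ → ℝ} {N : ℕ} {δ : ℝ} {x y z : ℕ}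
    (hF : ∀ a ≤ 1, ∀ b ≤ 1, ∀ c ≤ 1,
      |F (((x + a : ℕ) : ℝ) / N, ((y + b : ℕ) : ℝ) / N, ((z + c : ℕ) : ℝ) / N)
        - F ((x : ℝ) / N, (y : ℝ) / N, (z : ℝ) / N)| < δ)
    (h : ¬ ConstOnCube (fun x y z => if 0 < F ((x : ℝ) / N, (y : ℝ) / N, (z : ℝ) / N)
      then 1 else 0) x y z) :
    |F ((x : ℝ) / N, (y : ℝ) / N, (z : ℝ) / N)| ≤ δ := by
  by_contra hlt
  push Not at hlt
  apply h
  intro a ha b hb c hc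
  have h1 := abs_lt.1 (hF a ha b hb c hc)
  have hδ : 0 < δ := (abs_nonneg _).trans_lt (hF a ha b hb c hc)
  dsimp only
  rcases lt_abs.1 hlt with h2 | h2
  · rw [if_pos (by linarith), if_pos (by linarith)]
  · rw [if_neg (by linarith), if_neg (by linarith)]

/-- Without a common zero, |F| + |G| + |H| has a positive minimum on the cube. On a fine enough
mesh, the discrete theorem applied to the indicators of positivity finds a small cube on which all
three signs change, and there the sum is below that minimum. -/
theorem poincare_miranda {F G H : ℝ × ℝ × ℝ → ℝ} (hF : Continuous F) (hG : Continuous G)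
    (hH : Continuous H)
    (F0 : ∀ y ∈ Icc (0 : ℝ) 1, ∀ z ∈ Icc (0 : ℝ) 1, F (0, y, z) < 0)
    (F1 : ∀ y ∈ Icc (0 : ℝ) 1, ∀ z ∈ Icc (0 : ℝ) 1, 0 < F (1, y, z))
    (G0 : ∀ x ∈ Icc (0 : ℝ) 1, ∀ z ∈ Icc (0 : ℝ) 1, G (x, 0, z) < 0)
    (G1 : ∀ x ∈ Icc (0 : ℝ) 1, ∀ z ∈ Icc (0 : ℝ) 1, 0 < G (x, 1, z))
    (H0 : ∀ x ∈ Icc (0 : ℝ) 1, ∀ y ∈ Icc (0 : ℝ) 1, H (x, y, 0) < 0)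
    (H1 : ∀ x ∈ Icc (0 : ℝ) 1, ∀ y ∈ Icc (0 : ℝ) 1, 0 < H (x, y, 1)) :
    ∃ x ∈ Icc (0 : ℝ) 1, ∃ y ∈ Icc (0 : ℝ) 1, ∃ z ∈ Icc (0 : ℝ) 1,
      F (x, y, z) = 0 ∧ G (x, y, z) = 0 ∧ H (x, y, z) = 0 := by
  have hK : IsCompact (Icc (0 : ℝ) 1 ×ˢ Icc (0 : ℝ) 1 ×ˢ Icc (0 : ℝ) 1) :=
    isCompact_Icc.prod (isCompact_Icc.prod isCompact_Icc)
  set K := Icc (0 : ℝ) 1 ×ˢ Icc (0 : ℝ) 1 ×ˢ Icc (0 : ℝ) 1 with hKdef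
  have hS : Continuous fun p => |F p| + |G p| + |H p| := by fun_prop
  obtain ⟨p₀, hp₀, hmin⟩ := hK.exists_isMinOn ⟨(0, 0, 0), by simp [hKdef]⟩ hS.continuousOn
  by_cases hz : |F p₀| + |G p₀| + |H p₀| = 0
  · have a1 := abs_nonneg (F p₀)
    have a2 := abs_nonneg (G p₀)
    have a3 := abs_nonneg (H p₀)
    exact ⟨p₀.1, hp₀.1, p₀.2.1, hp₀.2.1, p₀.2.2, hp₀.2.2, abs_eq_zero.1 (by linarith),
      abs_eq_zero.1 (by linarith), abs_eq_zero.1 (by linarith)⟩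
  exfalso
  have hpos : 0 < |F p₀| + |G p₀| + |H p₀| := lt_of_le_of_ne (by positivity) (Ne.symm hz)
  -- A quarter of the minimum: three errors of size `δ` still add up to less than the minimum.
  set δ := (|F p₀| + |G p₀| + |H p₀|) / 4 with hδ
  have hδ0 : 0 < δ := by positivity
  have hu := hK.uniformContinuousOn_of_continuous
    ((hF.prodMk (hG.prodMk hH)).continuousOn)
  obtain ⟨ε, hε, hu⟩ := Metric.uniformContinuousOn_iff.1 hu δ hδ0
  obtain ⟨M, hM⟩ := exists_nat_one_div_lt hε
  set N := M + 1 with hN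
  have hN0 : (0 : ℝ) < N := by positivity
  have hinv : 1 / (N : ℝ) < ε := by rw [hN]; push_cast; exact hM
  have hmem : ∀ k : ℕ, k ≤ N → (k : ℝ) / N ∈ Icc (0 : ℝ) 1 := fun k hk =>
    ⟨by positivity, (div_le_one hN0).2 (by exact_mod_cast hk)⟩
  have hNN : ((N : ℕ) : ℝ) / N = 1 := div_self hN0.ne'
  let ind : (ℝ × ℝ × ℝ → ℝ) → ℕ → ℕ → ℕ → ℤ := fun F x y z =>
    if 0 < F ((x : ℝ) / N, (y : ℝ) / N, (z : ℝ) / N) then 1 else 0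
  obtain ⟨x, hx, y, hy, z, hz, nf, ng, nh⟩ := exists_cube_not_const N (ind F) (ind G) (ind H)
    (fun y hy z hz => by simpa [ind] using (F0 _ (hmem y hy) _ (hmem z hz)).le)
    (fun y hy z hz => by simpa [ind, hNN] using F1 _ (hmem y hy) _ (hmem z hz))
    (fun y hy z hz => by simpa [ind] using (G0 _ (hmem y hy) _ (hmem z hz)).le)
    (fun y hy z hz => by simpa [ind, hNN] using G1 _ (hmem y hy) _ (hmem z hz))
    (fun y hy z hz => by simpa [ind] using (H0 _ (hmem y hy) _ (hmem z hz)).le)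
    (fun y hy z hz => by simpa [ind, hNN] using H1 _ (hmem y hy) _ (hmem z hz))
  have hstep : ∀ k a : ℕ, a ≤ 1 → dist (((k + a : ℕ) : ℝ) / N) ((k : ℝ) / N) < ε := by
    intro k a ha
    rw [Real.dist_eq, ← sub_div, Nat.cast_add, add_sub_cancel_left, abs_of_nonneg (by positivity)]
    refine lt_of_le_of_lt ?_ hinv
    gcongr
    exact_mod_cast ha
  have hclose : ∀ a ≤ 1, ∀ b ≤ 1, ∀ c ≤ 1, dist
      (F (((x + a : ℕ) : ℝ) / N, ((y + b : ℕ) : ℝ) / N, ((z + c : ℕ) : ℝ) / N),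
       G (((x + a : ℕ) : ℝ) / N, ((y + b : ℕ) : ℝ) / N, ((z + c : ℕ) : ℝ) / N),
       H (((x + a : ℕ) : ℝ) / N, ((y + b : ℕ) : ℝ) / N, ((z + c : ℕ) : ℝ) / N))
      (F ((x : ℝ) / N, (y : ℝ) / N, (z : ℝ) / N), G ((x : ℝ) / N, (y : ℝ) / N, (z : ℝ) / N),
       H ((x : ℝ) / N, (y : ℝ) / N, (z : ℝ) / N)) < δ := by
    intro a ha b hb c hc
    refine hu _ ⟨hmem _ (by omega), hmem _ (by omega), hmem _ (by omega)⟩ _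
      ⟨hmem _ hx.le, hmem _ hy.le, hmem _ hz.le⟩ ?_
    rw [Prod.dist_eq, Prod.dist_eq]
    exact max_lt (hstep x a ha) (max_lt (hstep y b hb) (hstep z c hc))
  have bF := abs_le_of_not_constOnCube (F := F) (δ := δ) (fun a ha b hb c hc =>
    lt_of_le_of_lt (le_max_left _ _) (hclose a ha b hb c hc)) nf
  have bG := abs_le_of_not_constOnCube (F := G) (δ := δ) (fun a ha b hb c hc =>
    lt_of_le_of_lt ((le_max_left _ _).trans (le_max_right _ _)) (hclose a ha b hb c hc)) ng
  have bH := abs_le_of_not_constOnCube (F := H) (δ := δ) (fun a ha b hb c hc =>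
    lt_of_le_of_lt ((le_max_right _ _).trans (le_max_right _ _)) (hclose a ha b hb c hc)) nh
  have := hmin (a := ((x : ℝ) / N, (y : ℝ) / N, (z : ℝ) / N))
    ⟨hmem _ hx.le, hmem _ hy.le, hmem _ hz.le⟩
  simp only [mem_ofPred_eq] at this
  linarith

/-! ### Countable closed partitions -/

/-- A connected, locally connected compact Hausdorff space is not the union of countably many, but
more than one, disjoint nonempty closed sets. -/
theorem exists_eq_univ_of_countable_closed_partition {X ι : Type*} [TopologicalSpace X]
    [CompactSpace X] [T2Space X] [LocallyConnectedSpace X] [PreconnectedSpace X] [Nonempty X]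
    [Countable ι] (F : ι → Set X) (hc : ∀ i, IsClosed (F i))
    (hd : ∀ i j, i ≠ j → Disjoint (F i) (F j)) (hu : ⋃ i, F i = univ) :
    ∃ i, F i = univ := by
  have huniq : ∀ {x i j}, x ∈ F i → x ∈ F j → i = j := fun hi hj => by
    by_contra hij
    exact (hd _ _ hij).le_bot ⟨hi, hj⟩
  set B : Set X := (⋃ i, interior (F i))ᶜ with hB
  have hBc : IsClosed B := (isOpen_iUnion fun i => isOpen_interior).isClosed_compl
  have hempty : B = ∅ := by
    by_contra hne
    obtain ⟨b₀, hb₀⟩ := nonempty_iff_ne_empty.2 hne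
    have : Nonempty B := ⟨⟨b₀, hb₀⟩⟩
    have : CompactSpace B := isCompact_iff_compactSpace.1 hBc.isCompact
    -- Baire's theorem in the compact set `B` of points interior to no `F i`: near `b`, all of `B`
    -- lies in a single `F n`. The contradiction will be that `b` is interior to `F n`.
    obtain ⟨n, ⟨b, hbB⟩, hb⟩ := nonempty_interior_of_iUnion_of_closed
      (f := fun i => ((↑) : B → X) ⁻¹' F i)
      (fun i => (hc i).preimage continuous_subtype_val)
      (by rw [← preimage_iUnion, hu, preimage_univ])
    obtain ⟨V, hVs, hVo, hbV⟩ := mem_interior.1 hb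
    obtain ⟨U, hUo, rfl⟩ := isOpen_induced_iff.1 hVo
    obtain ⟨J, hJU, hJo, hbJ, hJ⟩ := locallyConnectedSpace_iff_subsets_isOpen_isConnected.1
      inferInstance b U (hUo.mem_nhds hbV)
    have hJB : ∀ y ∈ J, y ∈ B → y ∈ F n := fun y hy hyB => hVs (a := ⟨y, hyB⟩) (hJU hy)
    have hJn : J ⊆ F n := by
      intro x hx
      by_contra hxn
      have hxB : x ∉ B := fun h => hxn (hJB x hx h)
      obtain ⟨m, hm⟩ := mem_iUnion.1 (notMem_compl_iff.1 hxB)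
      -- The connected set `J` contains `x` inside and `b` outside the interior of `F m`, so it
      -- meets the frontier. A frontier point is in `F m` and in `B`, hence in `F n` as well.
      obtain ⟨y, hyJ, hy⟩ : ∃ y ∈ J, y ∈ frontier (interior (F m)) := by
        by_contra! hfr
        have hbm : b ∉ interior (F m) := fun h => hbB (mem_iUnion.2 ⟨m, h⟩)
        have hsplit : ∀ y ∈ J, y ∉ interior (F m) → y ∈ (closure (interior (F m)))ᶜ :=
          fun y hy h hcl => hfr y hy ⟨hcl, by rwa [interior_interior]⟩
        obtain ⟨y, -, h1, h2⟩ := hJ.isPreconnected _ _ isOpen_interior isClosed_closure.isOpen_compl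
          (fun y hy => (em (y ∈ interior (F m))).imp id (hsplit y hy)) ⟨x, hx, hm⟩
          ⟨b, hbJ, hsplit b hbJ hbm⟩
        exact h2 (subset_closure h1)
      have hym : y ∈ F m := (hc m).closure_subset (closure_mono interior_subset hy.1)
      have hyB : y ∈ B := by
        intro h
        obtain ⟨k, hk⟩ := mem_iUnion.1 h
        obtain rfl := huniq hym (interior_subset hk)
        exact hy.2 (by rwa [interior_interior])
      obtain rfl := huniq hym (hJB y hyJ hyB)
      exact hxn (interior_subset hm)
    exact hbB (mem_iUnion.2 ⟨n, mem_interior.2 ⟨J, hJn, hJo, hbJ⟩⟩)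
  have hcov : ∀ x, ∃ i, x ∈ interior (F i) := fun x => by
    have : x ∉ B := by rw [hempty]; exact notMem_empty x
    exact mem_iUnion.1 (notMem_compl_iff.1 this)
  obtain ⟨x₀⟩ := ‹Nonempty X›
  obtain ⟨i, hi⟩ := hcov x₀
  have hopen : IsOpen (F i) := by
    rw [← interior_eq_iff_isOpen]
    refine subset_antisymm interior_subset fun x hx => ?_
    obtain ⟨j, hj⟩ := hcov x
    rwa [huniq hx (interior_subset hj)]
  exact ⟨i, IsClopen.eq_univ ⟨hc i, hopen⟩ ⟨x₀, interior_subset hi⟩⟩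

/-! ### Paths of right-handed bases -/

/-- Invertible real matrices. -/
def nonsingular : Set (Matrix (Fin 3) (Fin 3) ℝ) := {A | A.det ≠ 0}

theorem joinedIn_nonsingular_mul {A A' B B' : Matrix (Fin 3) (Fin 3) ℝ}
    (h : JoinedIn nonsingular A A') (h' : JoinedIn nonsingular B B') :
    JoinedIn nonsingular (A * B) (A' * B') := by
  obtain ⟨γ, hγ⟩ := h
  obtain ⟨γ', hγ'⟩ := h'
  refine ⟨⟨⟨fun t => γ t * γ' t, by fun_prop⟩, by simp, by simp⟩, fun t => ?_⟩
  change (γ t * γ' t).det ≠ 0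
  rw [Matrix.det_mul]
  exact mul_ne_zero (hγ t) (hγ' t)

theorem joinedIn_nonsingular_of_segment {A B : Matrix (Fin 3) (Fin 3) ℝ}
    (h : ∀ t ∈ Icc (0 : ℝ) 1, ((1 - t) • A + t • B).det ≠ 0) : JoinedIn nonsingular A B :=
  ⟨⟨⟨fun t => (1 - (t : ℝ)) • A + (t : ℝ) • B, by fun_prop⟩, by simp, by simp⟩, fun t => h t t.2⟩

/-- The reflection in the coordinate plane orthogonal to the first axis. -/
def reflection₀ : Matrix (Fin 3) (Fin 3) ℝ := Matrix.diagonal ![-1, 1, 1]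

/-- Transvections and positive diagonal entries contract linearly to the identity, and negative
entries to -1. The class of matrices joined to one of the two representatives is closed under
products, because the reflection squares to 1. -/
theorem joinedIn_one_or_reflection {A : Matrix (Fin 3) (Fin 3) ℝ} (hA : A.det ≠ 0) :
    JoinedIn nonsingular A 1 ∨ JoinedIn nonsingular A reflection₀ := by
  let P : Matrix (Fin 3) (Fin 3) ℝ → Prop := fun A =>
    JoinedIn nonsingular A 1 ∨ JoinedIn nonsingular A reflection₀
  have hsq : reflection₀ * reflection₀ = 1 := by
    rw [reflection₀, Matrix.diagonal_mul_diagonal, ← Matrix.diagonal_one]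
    congr 1; ext i; fin_cases i <;> simp
  have hmul : ∀ A B, P A → P B → P (A * B) := by
    rintro A B (hA | hA) (hB | hB)
    · exact Or.inl (by simpa using joinedIn_nonsingular_mul hA hB)
    · exact Or.inr (by simpa using joinedIn_nonsingular_mul hA hB)
    · exact Or.inr (by simpa using joinedIn_nonsingular_mul hA hB)
    · exact Or.inl (by simpa [hsq] using joinedIn_nonsingular_mul hA hB)
  have hpos : ∀ s : ℝ, s ∈ Icc (0:ℝ) 1 → 0 < (1 - s) ^ 2 + s ^ 2 := fun s _ => by
    nlinarith [sq_nonneg (1 - 2 * s)]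
  have hrefl : P reflection₀ := Or.inr (JoinedIn.refl (by
    simp [nonsingular, reflection₀, Matrix.det_diagonal, Fin.prod_univ_three]))
  -- The detour through a coordinate swap works since on both segments the determinant is -((1 - s)²
  -- + s²).
  have h01 : JoinedIn nonsingular (Matrix.diagonal ![1, -1, 1]) reflection₀ := by
    refine JoinedIn.trans (y := !![0, 1, 0; 1, 0, 0; 0, 0, 1]) ?_ ?_ <;>
    · refine joinedIn_nonsingular_of_segment fun s hs => ?_
      have := hpos s hs
      simp [Matrix.det_fin_three, reflection₀]
      intro h
      nlinarith
  have h02 : JoinedIn nonsingular (Matrix.diagonal ![1, 1, -1]) reflection₀ := by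
    refine JoinedIn.trans (y := !![0, 0, 1; 0, 1, 0; 1, 0, 0]) ?_ ?_ <;>
    · refine joinedIn_nonsingular_of_segment fun s hs => ?_
      have := hpos s hs
      simp [Matrix.det_fin_three, reflection₀]
      intro h
      nlinarith
  have hone : P 1 := Or.inl (JoinedIn.refl (by simp [nonsingular]))
  have hseg : ∀ x : ℝ, x ≠ 0 → ∀ s ∈ Icc (0:ℝ) 1,
      (1 - s) * x + s * (if 0 < x then 1 else -1) ≠ 0 := by
    intro x hx s hs
    rcases hx.lt_or_gt with h | h
    · rw [if_neg h.not_gt]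
      rcases eq_or_lt_of_le hs.1 with rfl | h0
      · simpa using hx
      · nlinarith [mul_nonneg (sub_nonneg.2 hs.2) (neg_pos.2 h).le]
    · rw [if_pos h]
      rcases eq_or_lt_of_le hs.1 with rfl | h0
      · simpa using hx
      · nlinarith [mul_nonneg (sub_nonneg.2 hs.2) h.le]
  refine Matrix.diagonal_transvection_induction_of_det_ne_zero P A hA ?_ ?_ ?_
  · intro d hd
    have hd' : ∀ i, d i ≠ 0 := fun i => by
      rw [Matrix.det_diagonal] at hd
      exact Finset.prod_ne_zero_iff.1 hd i (Finset.mem_univ i)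
    let e : Fin 3 → ℝ := fun i => if 0 < d i then 1 else -1
    have hj : JoinedIn nonsingular (Matrix.diagonal d) (Matrix.diagonal e) := by
      refine joinedIn_nonsingular_of_segment fun s hs => ?_
      rw [← Matrix.diagonal_smul, ← Matrix.diagonal_smul, Matrix.diagonal_add,
        Matrix.det_diagonal]
      exact Finset.prod_ne_zero_iff.2 fun i _ => hseg _ (hd' i) s hs
    have hP : P (Matrix.diagonal e) := by
      have : Matrix.diagonal e = Matrix.diagonal ![e 0, 1, 1] * Matrix.diagonal ![1, e 1, 1]
          * Matrix.diagonal ![1, 1, e 2] := by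
        rw [Matrix.diagonal_mul_diagonal, Matrix.diagonal_mul_diagonal]
        congr 1; ext i; fin_cases i <;> simp
      rw [this]
      have hI : Matrix.diagonal ![(1:ℝ), 1, 1] = 1 := by
        rw [← Matrix.diagonal_one]; congr 1; ext i; fin_cases i <;> simp
      refine hmul _ _ (hmul _ _ ?_ ?_) ?_
      · by_cases h : 0 < d 0
        · simpa [e, h, hI] using hone
        · simpa [e, h, reflection₀] using hrefl
      · by_cases h : 0 < d 1
        · simpa [e, h, hI] using hone
        · simpa [e, h] using Or.inr h01
      · by_cases h : 0 < d 2
        · simpa [e, h, hI] using hone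
        · simpa [e, h] using Or.inr h02
    exact hP.imp hj.trans hj.trans
  · intro t
    refine Or.inl (joinedIn_nonsingular_of_segment fun s _ => ?_)
    have : (1 - s) • t.toMatrix + s • (1 : Matrix (Fin 3) (Fin 3) ℝ)
        = Matrix.transvection t.i t.j ((1 - s) * t.c) := by
      rw [Matrix.TransvectionStruct.toMatrix, Matrix.transvection, Matrix.transvection, smul_add,
        Matrix.smul_single, smul_eq_mul, add_right_comm, ← add_smul]
      simp
    rw [this, Matrix.det_transvection_of_ne _ _ t.hij]
    exact one_ne_zero
  · exact fun A B _ _ => hmul A B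

theorem det_pos_of_path {γ : unitInterval → Matrix (Fin 3) (Fin 3) ℝ} (hγ : Continuous γ)
    (h : ∀ t, (γ t).det ≠ 0) (h0 : 0 < (γ 0).det) (t : unitInterval) : 0 < (γ t).det := by
  by_contra hneg
  have hc : Continuous fun t => (γ t).det := hγ.matrix_det
  obtain ⟨s, hs⟩ := mem_range_of_exists_le_of_exists_ge hc ⟨t, not_lt.1 hneg⟩ ⟨0, h0.le⟩
  exact h s hs

/-- Each matrix is joined to 1 or to the reflection, and the sign of the determinant, constant along
the path, excludes the reflection. -/
theorem exists_path_det_pos {A B : Matrix (Fin 3) (Fin 3) ℝ} (hA : 0 < A.det) (hB : 0 < B.det) :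
    ∃ γ : unitInterval → Matrix (Fin 3) (Fin 3) ℝ, Continuous γ ∧ γ 0 = A ∧ γ 1 = B ∧
      ∀ t, 0 < (γ t).det := by
  have key : ∀ {A : Matrix (Fin 3) (Fin 3) ℝ}, 0 < A.det → JoinedIn nonsingular A 1 := by
    intro A hA
    refine (joinedIn_one_or_reflection hA.ne').resolve_right fun ⟨γ, hγ⟩ => ?_
    have := det_pos_of_path γ.continuous hγ (by simpa using hA) 1
    rw [γ.target] at this
    simp [reflection₀, Matrix.det_diagonal, Fin.prod_univ_three] at this
    linarith
  obtain ⟨γ, hγ⟩ := (key hA).trans (key hB).symm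
  exact ⟨γ, γ.continuous, γ.source, γ.target,
    det_pos_of_path γ.continuous hγ (by simpa using hA)⟩

/-! ### Homotopies of polygonal lines -/

/-- The polygonal line with vertices `X (-K), …, X K`, parametrized by `[-K, K]`. -/
def polyline (X : ℤ → Fin 3 → ℝ) (K : ℤ) (s : ℝ) : Fin 3 → ℝ :=
  ∑ j ∈ Finset.Icc (-K) K, max 0 (1 - |s - j|) • X j

theorem polyline_intCast (X : ℤ → Fin 3 → ℝ) {K j : ℤ} (hj : j ∈ Finset.Icc (-K) K) :
    polyline X K j = X j := by
  rw [polyline, Finset.sum_eq_single j]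
  · simp
  · intro i _ hij
    have : (1 : ℝ) ≤ |(j : ℝ) - i| := by
      exact_mod_cast Int.one_le_abs (sub_ne_zero.2 hij.symm)
    rw [max_eq_left (by linarith), zero_smul]
  · exact fun h => absurd hj h

theorem polyline_mem_segment (X : ℤ → Fin 3 → ℝ) {K : ℤ} {s : ℝ} (hs : s ∈ Icc (-K : ℝ) K) :
    ∃ j, polyline X K s ∈ segment ℝ (X j) (X (j + 1)) := by
  rcases eq_or_lt_of_le hs.2 with rfl | hlt
  · refine ⟨K, ?_⟩
    have hK : -K ≤ K := by exact_mod_cast hs.1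
    rw [polyline_intCast X (Finset.mem_Icc.2 ⟨hK, le_rfl⟩)]
    exact left_mem_segment _ _ _
  · have h1 : -K ≤ ⌊s⌋ := Int.le_floor.2 (by push_cast; exact hs.1)
    have h2 : ⌊s⌋ < K := Int.floor_lt.2 hlt
    have f1 := Int.floor_le s
    have f2 := Int.lt_floor_add_one s
    refine ⟨⌊s⌋, 1 - (s - ⌊s⌋), s - ⌊s⌋, by linarith, by linarith, by ring, ?_⟩
    have hsub : ({⌊s⌋, ⌊s⌋ + 1} : Finset ℤ) ⊆ Finset.Icc (-K) K := by
      intro i hi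
      rw [Finset.mem_insert, Finset.mem_singleton] at hi
      rw [Finset.mem_Icc]
      omega
    rw [polyline, ← Finset.sum_subset hsub, Finset.sum_pair (by omega)]
    · rw [abs_of_nonneg (by linarith), max_eq_right (by linarith)]
      rw [abs_of_nonpos (by push_cast; linarith), max_eq_right (by push_cast; linarith)]
      congr 2
      push_cast; ring
    · intro i _ hi
      rw [Finset.mem_insert, Finset.mem_singleton, not_or] at hi
      have : (1 : ℝ) ≤ |s - i| := by
        rcases lt_or_ge i ⌊s⌋ with h | h
        · have : (i : ℝ) + 1 ≤ ⌊s⌋ := by exact_mod_cast h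
          exact le_abs.2 (Or.inl (by linarith))
        · have : (⌊s⌋ : ℝ) + 2 ≤ i := by
            have : ⌊s⌋ + 2 ≤ i := by omega
            exact_mod_cast this
          exact le_abs.2 (Or.inr (by linarith))
      rw [max_eq_left (by linarith), zero_smul]

theorem apply_mem_Icc_of_mem_segment {x y p : Fin 3 → ℝ} {k : Fin 3} {l u : ℝ}
    (hx : x k ∈ Icc l u) (hy : y k ∈ Icc l u) (hp : p ∈ segment ℝ x y) : p k ∈ Icc l u := by
  obtain ⟨a, b, ha, hb, hab, rfl⟩ := hp
  exact convex_Icc l u hx hy ha hb hab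

/-- If, during a homotopy, the polygonal lines `X` and `Y` stay close to the axial directions
`a ≠ b`, and exchange their heights in the third direction, then they meet. -/
theorem exists_meet_of_exchange {a b c : Fin 3} (hab : a ≠ b) (hac : a ≠ c) (hbc : b ≠ c)
    {X Y : unitInterval → ℤ → Fin 3 → ℝ} (hX : ∀ j, Continuous fun t => X t j)
    (hY : ∀ j, Continuous fun t => Y t j) {C : ℝ}
    (hXa : ∀ t j, |X t j a - j| ≤ C) (hXb : ∀ t j, |X t j b| ≤ C)
    (hYb : ∀ t j, |Y t j b - j| ≤ C) (hYa : ∀ t j, |Y t j a| ≤ C)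
    {x₀ y₀ x₁ y₁ : ℝ} (hX₀ : ∀ j, X 0 j c = x₀) (hY₀ : ∀ j, Y 0 j c = y₀)
    (hX₁ : ∀ j, X 1 j c = x₁) (hY₁ : ∀ j, Y 1 j c = y₁) (h₀ : x₀ < y₀) (h₁ : y₁ < x₁) :
    ∃ t j l, (segment ℝ (X t j) (X t (j + 1)) ∩ segment ℝ (Y t l) (Y t (l + 1))).Nonempty := by
  -- With half-length above `2 * C`, the ends of each polygonal line lie beyond the strip of width
  -- `C` that contains the other one, which fixes the signs on the side faces of the box.
  obtain ⟨n, hn⟩ := exists_nat_gt (2 * C)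
  have hC : 0 ≤ C := (abs_nonneg _).trans (hXb 0 0)
  obtain ⟨K, hK⟩ : ∃ K : ℤ, K = n := ⟨n, rfl⟩
  have hKC : 2 * C < (K : ℝ) := by rw [hK]; exact_mod_cast hn
  have hK0 : (0 : ℝ) < K := by linarith
  have hK0' : 0 < K := by exact_mod_cast hK0
  let τ : ℝ → unitInterval := projIcc 0 1 zero_le_one
  have hτ : Continuous τ := continuous_projIcc
  have hτ0 : τ 0 = 0 := projIcc_left _
  have hτ1 : τ 1 = 1 := projIcc_right _
  let σ : ℝ → ℝ := fun s => K * (2 * s - 1)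
  have hσ : Continuous σ := by fun_prop
  have hσ0 : σ 0 = ((-K : ℤ) : ℝ) := by simp [σ]
  have hσ1 : σ 1 = (K : ℝ) := by simp only [σ]; ring
  have hσmem : ∀ s ∈ Icc (0 : ℝ) 1, σ s ∈ Icc (-K : ℝ) K := fun s hs =>
    ⟨by simp only [σ]; nlinarith [hs.1], by simp only [σ]; nlinarith [hs.2]⟩
  have hmemK : K ∈ Finset.Icc (-K) K := Finset.mem_Icc.2 ⟨by omega, le_rfl⟩
  have hmemK' : -K ∈ Finset.Icc (-K) K := Finset.mem_Icc.2 ⟨le_rfl, by omega⟩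
  have cX : ∀ k, Continuous fun p : ℝ × ℝ × ℝ => polyline (X (τ p.2.2)) K (σ p.1) k := by
    intro k
    simp only [polyline, Finset.sum_apply, Pi.smul_apply, smul_eq_mul]
    refine continuous_finsetSum _ fun j _ => ?_
    have := (continuous_apply k).comp ((hX j).comp (hτ.comp (continuous_snd.comp
      (continuous_snd (X := ℝ) (Y := ℝ × ℝ)))))
    simp only [Function.comp_def] at this
    fun_prop
  have cY : ∀ k, Continuous fun p : ℝ × ℝ × ℝ => polyline (Y (τ p.2.2)) K (σ p.2.1) k := by
    intro k
    simp only [polyline, Finset.sum_apply, Pi.smul_apply, smul_eq_mul]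
    refine continuous_finsetSum _ fun j _ => ?_
    have := (continuous_apply k).comp ((hY j).comp (hτ.comp (continuous_snd.comp
      (continuous_snd (X := ℝ) (Y := ℝ × ℝ)))))
    simp only [Function.comp_def] at this
    fun_prop
  have bX : ∀ t, ∀ s ∈ Icc (0 : ℝ) 1, polyline (X t) K (σ s) b ∈ Icc (-C) C := fun t s hs => by
    obtain ⟨j, hj⟩ := polyline_mem_segment (X t) (hσmem s hs)
    exact apply_mem_Icc_of_mem_segment (abs_le.1 (hXb t j)) (abs_le.1 (hXb t (j + 1))) hj
  have bY : ∀ t, ∀ s ∈ Icc (0 : ℝ) 1, polyline (Y t) K (σ s) a ∈ Icc (-C) C := fun t s hs => by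
    obtain ⟨j, hj⟩ := polyline_mem_segment (Y t) (hσmem s hs)
    exact apply_mem_Icc_of_mem_segment (abs_le.1 (hYa t j)) (abs_le.1 (hYa t (j + 1))) hj
  have height : ∀ {Z : ℤ → Fin 3 → ℝ} {z : ℝ}, (∀ j, Z j c = z) → ∀ s ∈ Icc (0 : ℝ) 1,
      polyline Z K (σ s) c = z := fun {Z z} hZ s hs => by
    obtain ⟨j, hj⟩ := polyline_mem_segment Z (hσmem s hs)
    have := apply_mem_Icc_of_mem_segment (k := c) (l := z) (u := z) (by simp [hZ]) (by simp [hZ]) hj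
    exact le_antisymm this.2 this.1
  -- The variables are the two curve parameters and time; the functions are the coordinate
  -- differences. The exchange of heights supplies the signs at the two ends of time.
  obtain ⟨s, hs, r, hr, t, -, e1, e2, e3⟩ := poincare_miranda
    (F := fun p => polyline (X (τ p.2.2)) K (σ p.1) a - polyline (Y (τ p.2.2)) K (σ p.2.1) a)
    (G := fun p => polyline (Y (τ p.2.2)) K (σ p.2.1) b - polyline (X (τ p.2.2)) K (σ p.1) b)
    (H := fun p => polyline (X (τ p.2.2)) K (σ p.1) c - polyline (Y (τ p.2.2)) K (σ p.2.1) c)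
    ((cX a).sub (cY a)) ((cY b).sub (cX b)) ((cX c).sub (cY c))
    (fun r hr t _ => by
      simp only [hσ0]
      rw [polyline_intCast _ hmemK']
      have h1 := (abs_le.1 (hXa (τ t) (-K))).2
      have h2 := (bY (τ t) r hr).1
      push_cast at h1
      linarith)
    (fun r hr t _ => by
      simp only [hσ1]
      rw [polyline_intCast _ hmemK]
      have h1 := (abs_le.1 (hXa (τ t) K)).1
      have h2 := (bY (τ t) r hr).2
      linarith)
    (fun s hs t _ => by
      simp only [hσ0]
      rw [polyline_intCast _ hmemK']
      have h1 := (abs_le.1 (hYb (τ t) (-K))).2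
      have h2 := (bX (τ t) s hs).1
      push_cast at h1
      linarith)
    (fun s hs t _ => by
      simp only [hσ1]
      rw [polyline_intCast _ hmemK]
      have h1 := (abs_le.1 (hYb (τ t) K)).1
      have h2 := (bX (τ t) s hs).2
      linarith)
    (fun s hs r hr => by
      simp only [hτ0]
      rw [height hX₀ s hs, height hY₀ r hr]
      linarith)
    (fun s hs r hr => by
      simp only [hτ1]
      rw [height hX₁ s hs, height hY₁ r hr]
      linarith)
  have heq : polyline (X (τ t)) K (σ s) = polyline (Y (τ t)) K (σ r) := by
    have hcov : ∀ k : Fin 3, k = a ∨ k = b ∨ k = c := by omega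
    ext k
    rcases hcov k with rfl | rfl | rfl
    · linarith
    · linarith
    · linarith
  obtain ⟨j, hj⟩ := polyline_mem_segment (X (τ t)) (hσmem s hs)
  obtain ⟨l, hl⟩ := polyline_mem_segment (Y (τ t)) (hσmem r hr)
  exact ⟨τ t, j, l, _, hj, heq ▸ hl⟩

section

/-! ### Grids in coordinates -/

/-- The point with coordinates `y` with respect to `b`. -/
def comb (b : Fin 3 → E3) : (Fin 3 → ℝ) →ₗ[ℝ] E3 := Fintype.linearCombination ℝ b

theorem comb_apply (b : Fin 3 → E3) (y : Fin 3 → ℝ) : comb b y = ∑ k, y k • b k := rfl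

theorem comb_single (b : Fin 3 → E3) (k : Fin 3) : comb b (Pi.single k 1) = b k := by
  simp [comb]

theorem comb_injective {b : Fin 3 → E3} (hb : LinearIndependent ℝ b) :
    Function.Injective (comb b) :=
  linearIndependent_iff_injective_fintypeLinearCombination.1 hb

/-- The real vector underlying an integer vector. -/
def latt : (Fin 3 → ℤ) →+ (Fin 3 → ℝ) where
  toFun z k := z k
  map_zero' := by ext; simp
  map_add' _ _ := by ext; simp

@[simp] theorem latt_apply (z : Fin 3 → ℤ) (k : Fin 3) : latt z k = z k := rfl

@[simp] theorem latt_single (k : Fin 3) (m : ℤ) :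
    latt (Pi.single k m) = Pi.single k (m : ℝ) := by
  ext l
  rcases eq_or_ne l k with rfl | h
  · simp
  · simp [h]

theorem latt_injective : Function.Injective latt := fun z w h => by
  ext k
  exact Int.cast_injective (α := ℝ) (congrFun h k)

variable {ι : Type*}

/-- A node of the grid with basis `b` and shifts `u`. -/
def node (b : Fin 3 → E3) (u : ι → Fin 3 → ℝ) (i : ι) (z : Fin 3 → ℤ) : E3 :=
  comb b (u i + latt z)

/-- An edge of the grid with basis `b` and shifts `u`. -/
def edge (b : Fin 3 → E3) (u : ι → Fin 3 → ℝ) (i : ι) (z : Fin 3 → ℤ) (k : Fin 3) : Sym2 E3 :=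
  s(node b u i z, node b u i (z + Pi.single k 1))

theorem node_add (b : Fin 3 → E3) (u : ι → Fin 3 → ℝ) (i : ι) (z w : Fin 3 → ℤ) :
    node b u i (z + w) = node b u i z + comb b (latt w) := by
  rw [node, node, map_add latt, ← add_assoc, map_add (comb b)]

theorem node_add_single (b : Fin 3 → E3) (u : ι → Fin 3 → ℝ) (i : ι) (z : Fin 3 → ℤ) (k : Fin 3) :
    node b u i (z + Pi.single k 1) = node b u i z + b k := by
  rw [node_add, latt_single, Int.cast_one, comb_single]

theorem mem_seg_edge {b : Fin 3 → E3} {u : ι → Fin 3 → ℝ} {i : ι} {z : Fin 3 → ℤ} {k : Fin 3}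
    {x : E3} : x ∈ seg (edge b u i z k) ↔
      ∃ s ∈ Icc (0 : ℝ) 1, x = comb b (u i + (latt z + Pi.single k s)) := by
  change x ∈ segment ℝ (node b u i z) (node b u i (z + Pi.single k 1)) ↔ _
  rw [segment_eq_image', node_add_single, add_sub_cancel_left]
  have h : ∀ s : ℝ, comb b (u i + (latt z + Pi.single k s)) = node b u i z + s • b k := fun s => by
    rw [← add_assoc, map_add (comb b), node]
    have : (Pi.single k s : Fin 3 → ℝ) = s • Pi.single k 1 := by
      ext l; rcases eq_or_ne l k with rfl | h
      · simp
      · simp [h]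
    rw [this, map_smul, comb_single]
  simp only [h, mem_image, eq_comm]

/-- No two shifts have coordinates that differ by an integer. -/
def Admissible (u : ι → Fin 3 → ℝ) : Prop :=
  ∀ i j, i ≠ j → ∀ k, ∀ m : ℤ, u i k - u j k ≠ m

/-- At least two of the coordinates of `y` are integers. -/
def Axial (y : Fin 3 → ℝ) : Prop := ∃ k, ∀ l, l ≠ k → ∃ m : ℤ, y l = m

theorem axial_latt_add_single (z : Fin 3 → ℤ) (k : Fin 3) (s : ℝ) :
    Axial (latt z + Pi.single k s) :=
  ⟨k, fun l hl => ⟨z l, by simp [hl]⟩⟩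

theorem axial_latt (z : Fin 3 → ℤ) : Axial (latt z) := ⟨0, fun l _ => ⟨z l, rfl⟩⟩

theorem Axial.exists_eq {y : Fin 3 → ℝ} (hy : Axial y) :
    ∃ z : Fin 3 → ℤ, ∃ k, ∃ s ∈ Icc (0 : ℝ) 1, y = latt z + Pi.single k s := by
  obtain ⟨k, hk⟩ := hy
  refine ⟨fun l => ⌊y l⌋, k, Int.fract (y k), ⟨Int.fract_nonneg _, (Int.fract_lt_one _).le⟩, ?_⟩
  ext l
  rcases eq_or_ne l k with rfl | h
  · simp
  · obtain ⟨m, hm⟩ := hk l h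
    simp [h, hm]

/-- Each axial vector has at most one nonintegral coordinate, so of the three coordinates some `l`
is integral in both. There the shifts would differ by an integer if the components were distinct. -/
theorem Admissible.eq_of_add_eq {u : ι → Fin 3 → ℝ} (hu : Admissible u) {i j : ι}
    {y y' : Fin 3 → ℝ} (hy : Axial y) (hy' : Axial y') (h : u i + y = u j + y') :
    i = j ∧ y = y' := by
  have hij : i = j := by
    by_contra hij
    obtain ⟨k, hk⟩ := hy
    obtain ⟨k', hk'⟩ := hy'
    obtain ⟨l, h1, h2⟩ : ∃ l, l ≠ k ∧ l ≠ k' := by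
      have : ∀ k k' : Fin 3, ∃ l, l ≠ k ∧ l ≠ k' := by decide
      exact this k k'
    obtain ⟨m, hm⟩ := hk l h1
    obtain ⟨m', hm'⟩ := hk' l h2
    refine hu i j hij l (m' - m) ?_
    have := congrFun h l
    simp only [Pi.add_apply, hm, hm'] at this
    push_cast
    linarith
  subst hij
  exact ⟨rfl, add_left_cancel h⟩

theorem node_injective {b : Fin 3 → E3} (hb : LinearIndependent ℝ b) {u : ι → Fin 3 → ℝ}
    (hu : Admissible u) {i j : ι} {z w : Fin 3 → ℤ} (h : node b u i z = node b u j w) :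
    i = j ∧ z = w := by
  obtain ⟨h1, h2⟩ := hu.eq_of_add_eq (axial_latt z) (axial_latt w) (comb_injective hb h)
  exact ⟨h1, latt_injective h2⟩

theorem mem_translations {b : Fin 3 → E3} {v : E3} :
    v ∈ translations b ↔ ∃ z, v = comb b (latt z) := by
  constructor
  · intro hv
    induction hv using AddSubgroup.closure_induction with
    | mem x hx =>
      obtain ⟨k, rfl⟩ := hx
      exact ⟨Pi.single k 1, by rw [latt_single, Int.cast_one, comb_single]⟩
    | zero => exact ⟨0, by simp⟩
    | add x y _ _ hx hy =>
      obtain ⟨z, rfl⟩ := hx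
      obtain ⟨w, rfl⟩ := hy
      exact ⟨z + w, by rw [map_add, map_add]⟩
    | neg x _ hx =>
      obtain ⟨z, rfl⟩ := hx
      exact ⟨-z, by rw [map_neg, map_neg]⟩
  · rintro ⟨z, rfl⟩
    rw [comb_apply]
    refine sum_mem fun k _ => ?_
    rw [latt_apply, Int.cast_smul_eq_zsmul]
    exact zsmul_mem (AddSubgroup.subset_closure (mem_range_self k)) _

/-- The nodes of the grid with basis `b` and shifts `u`. -/
def gridNodes (b : Fin 3 → E3) (u : ι → Fin 3 → ℝ) : Set E3 := {x | ∃ i z, x = node b u i z}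

/-- The edges of the grid with basis `b` and shifts `u`. -/
def gridEdges (b : Fin 3 → E3) (u : ι → Fin 3 → ℝ) : Set (Sym2 E3) :=
  {e | ∃ i z k, e = edge b u i z k}

theorem edge_map_add (b : Fin 3 → E3) (u : ι → Fin 3 → ℝ) (i : ι) (z w : Fin 3 → ℤ) (k : Fin 3) :
    (edge b u i z k).map (fun x => x + comb b (latt w)) = edge b u i (z + w) k := by
  rw [edge, Sym2.map_mk, edge, ← node_add, ← node_add]
  rw [add_right_comm]

theorem isPeriodicityBasis_grid [Finite ι] {b : Fin 3 → E3} (hb : LinearIndependent ℝ b)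
    (u : ι → Fin 3 → ℝ) : IsPeriodicityBasis (gridNodes b u) (gridEdges b u) b where
  linearIndependent := hb
  nodes_invariant := by
    rintro v hv _ ⟨i, z, rfl⟩
    obtain ⟨w, rfl⟩ := mem_translations.1 hv
    exact ⟨i, z + w, (node_add b u i z w).symm⟩
  edges_invariant := by
    rintro v hv _ ⟨i, z, k, rfl⟩
    obtain ⟨w, rfl⟩ := mem_translations.1 hv
    exact ⟨i, z + w, k, edge_map_add b u i z w k⟩
  nodes_finite := by
    refine ⟨range fun i => node b u i 0, finite_range _, ?_, ?_⟩
    · rintro _ ⟨i, rfl⟩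
      exact ⟨i, 0, rfl⟩
    · rintro _ ⟨i, z, rfl⟩
      exact ⟨_, ⟨i, rfl⟩, _, mem_translations.2 ⟨z, rfl⟩, by rw [← node_add, zero_add]⟩
  edges_finite := by
    refine ⟨range fun p : ι × Fin 3 => edge b u p.1 0 p.2, finite_range _, ?_, ?_⟩
    · rintro _ ⟨p, rfl⟩
      exact ⟨p.1, 0, p.2, rfl⟩
    · rintro _ ⟨i, z, k, rfl⟩
      exact ⟨_, ⟨(i, k), rfl⟩, _, mem_translations.2 ⟨z, rfl⟩, by rw [edge_map_add, zero_add]⟩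

theorem eq_zero_or_one_of_intCast {s : ℝ} (hs : s ∈ Icc (0 : ℝ) 1) {m : ℤ} (h : s = m) :
    s = 0 ∨ s = 1 := by
  subst h
  have h0 : 0 ≤ m := by exact_mod_cast hs.1
  have h1 : m ≤ 1 := by exact_mod_cast hs.2
  rcases (by omega : m = 0 ∨ m = 1) with rfl | rfl <;> simp

theorem mem_edge_of_eq_zero_or_one (b : Fin 3 → E3) (u : ι → Fin 3 → ℝ) (i : ι) (z : Fin 3 → ℤ)
    (k : Fin 3) {s : ℝ} (hs : s = 0 ∨ s = 1) :
    comb b (u i + (latt z + Pi.single k s)) ∈ edge b u i z k := by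
  rw [edge, Sym2.mem_iff]
  rcases hs with rfl | rfl
  · left; simp [node]
  · right; simp [node]

theorem grid_noncrossing {b : Fin 3 → E3} (hb : LinearIndependent ℝ b) {u : ι → Fin 3 → ℝ}
    (hu : Admissible u) : ∀ e ∈ gridEdges b u, ∀ d ∈ gridEdges b u, e ≠ d →
      ∀ x, x ∈ seg e → x ∈ seg d → x ∈ e ∧ x ∈ d := by
  rintro _ ⟨i, z, k, rfl⟩ _ ⟨j, w, l, rfl⟩ hne x hx hx'
  obtain ⟨s, hs, rfl⟩ := mem_seg_edge.1 hx
  obtain ⟨r, hr, h⟩ := mem_seg_edge.1 hx'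
  obtain ⟨rfl, hy⟩ := hu.eq_of_add_eq (axial_latt_add_single z k s) (axial_latt_add_single w l r)
    (comb_injective hb h)
  suffices hsr : (s = 0 ∨ s = 1) ∧ (r = 0 ∨ r = 1) from
    ⟨mem_edge_of_eq_zero_or_one b u i z k hsr.1, h ▸ mem_edge_of_eq_zero_or_one b u i w l hsr.2⟩
  have hk := congrFun hy k
  have hl := congrFun hy l
  rcases eq_or_ne k l with rfl | hkl
  · simp only [Pi.add_apply, latt_apply, Pi.single_eq_same] at hk
    have hzw : z k ≠ w k := by
      intro hzk
      apply hne
      have : z = w := by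
        ext m
        rcases eq_or_ne m k with rfl | hm
        · exact hzk
        · have := congrFun hy m
          simp only [Pi.add_apply, latt_apply, Pi.single_eq_of_ne hm, add_zero] at this
          exact_mod_cast this
      rw [this]
    rcases lt_or_gt_of_ne hzw with hlt | hlt
    · have : (z k : ℝ) + 1 ≤ w k := by exact_mod_cast hlt
      exact ⟨Or.inr (by linarith [hs.2, hr.1]), Or.inl (by linarith [hs.2, hr.1])⟩
    · have : (w k : ℝ) + 1 ≤ z k := by exact_mod_cast hlt
      exact ⟨Or.inl (by linarith [hr.2, hs.1]), Or.inr (by linarith [hr.2, hs.1])⟩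
  · simp only [Pi.add_apply, latt_apply, Pi.single_eq_same, Pi.single_eq_of_ne hkl,
      Pi.single_eq_of_ne hkl.symm, add_zero] at hk hl
    exact ⟨eq_zero_or_one_of_intCast hs (m := w k - z k) (by push_cast; linarith),
      eq_zero_or_one_of_intCast hr (m := z l - w l) (by push_cast; linarith)⟩

/-- The framed grid with basis `b` and shifts `u`, in which the component `o` is distinguished. -/
def gridNet [Finite ι] (o : ι) (b : Fin 3 → E3) (u : ι → Fin 3 → ℝ) (hb : LinearIndependent ℝ b)
    (hu : Admissible u) : ColouredNet where
  nodes := gridNodes b u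
  edges := gridEdges b u
  countable := by
    have : gridEdges b u = range fun p : ι × (Fin 3 → ℤ) × Fin 3 => edge b u p.1 p.2.1 p.2.2 := by
      ext e
      constructor
      · rintro ⟨i, z, k, rfl⟩
        exact ⟨(i, z, k), rfl⟩
      · rintro ⟨p, rfl⟩
        exact ⟨p.1, p.2.1, p.2.2, rfl⟩
    rw [this]
    have := Finite.to_countable (α := ι)
    exact countable_range _
  nondegenerate := by
    rintro _ ⟨i, z, k, rfl⟩ h
    rw [edge, Sym2.mk_isDiag_iff, node_add_single] at h
    exact hb.ne_zero k (left_eq_add.1 h)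
  noncrossing := grid_noncrossing hb hu
  nodes_eq := by
    ext x
    constructor
    · rintro ⟨i, z, rfl⟩
      exact ⟨_, ⟨i, z, 0, rfl⟩, Sym2.mem_mk_left _ _⟩
    · rintro ⟨_, ⟨i, z, k, rfl⟩, hx⟩
      rcases Sym2.mem_iff.1 hx with rfl | rfl
      · exact ⟨i, z, rfl⟩
      · exact ⟨i, _, rfl⟩
  periodic := ⟨b, isPeriodicityBasis_grid hb u⟩
  frame := {x | ∃ z, x = node b u o z}
  frame_subset := by
    rintro _ ⟨z, rfl⟩
    exact ⟨o, z, rfl⟩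

theorem colouredNet_ext {M M' : ColouredNet} (h1 : M.nodes = M'.nodes) (h2 : M.edges = M'.edges)
    (h3 : M.frame = M'.frame) : M = M' := by
  obtain ⟨⟨⟩, _⟩ := M
  obtain ⟨⟨⟩, _⟩ := M'
  simp only at h1 h2 h3
  subst h1 h2 h3
  rfl

theorem body_gridNet [Finite ι] (o : ι) {b : Fin 3 → E3} {u : ι → Fin 3 → ℝ}
    (hb : LinearIndependent ℝ b) (hu : Admissible u) :
    (gridNet o b u hb hu).body = {x | ∃ i y, Axial y ∧ x = comb b (u i + y)} := by
  ext x
  simp only [Net.body, bodyOf, mem_iUnion]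
  constructor
  · rintro ⟨_, ⟨i, z, k, rfl⟩, hx⟩
    obtain ⟨s, -, rfl⟩ := mem_seg_edge.1 hx
    exact ⟨i, _, axial_latt_add_single z k s, rfl⟩
  · rintro ⟨i, y, hy, rfl⟩
    obtain ⟨z, k, s, hs, rfl⟩ := hy.exists_eq
    exact ⟨_, ⟨i, z, k, rfl⟩, mem_seg_edge.2 ⟨s, hs, rfl⟩⟩

end

/-! ### Framed grids are coordinate grids -/

theorem det_ne_zero_iff_linearIndependent {b : Fin 3 → E3} :
    (Matrix.of fun i j : Fin 3 => b i j).det ≠ 0 ↔ LinearIndependent ℝ b := by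
  rw [← isUnit_iff_ne_zero, ← Matrix.isUnit_iff_isUnit_det, ← Matrix.linearIndependent_rows_iff_isUnit]
  exact (WithLp.linearEquiv 2 ℝ (Fin 3 → ℝ)).toLinearMap.linearIndependent_iff
    (LinearMap.ker_eq_bot.2 (WithLp.linearEquiv 2 ℝ (Fin 3 → ℝ)).injective)

theorem RightHanded.linearIndependent {b : Fin 3 → E3} (hb : RightHanded b) :
    LinearIndependent ℝ b :=
  det_ne_zero_iff_linearIndependent.1 (ne_of_gt hb)

theorem comb_surjective {b : Fin 3 → E3} (hb : LinearIndependent ℝ b) :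
    Function.Surjective (comb b) :=
  (LinearMap.injective_iff_surjective_of_finrank_eq_finrank (by simp)).1 (comb_injective hb)

theorem rightHanded_or_neg {b : Fin 3 → E3} (hb : LinearIndependent ℝ b) :
    RightHanded b ∨ RightHanded (-b) := by
  rcases (det_ne_zero_iff_linearIndependent.2 hb).lt_or_gt with h | h
  · right
    have : (Matrix.of fun i j : Fin 3 => (-b) i j) = -Matrix.of fun i j : Fin 3 => b i j := by
      ext i j; simp
    rw [RightHanded, this, Matrix.det_neg]
    norm_num
    exact h
  · exact Or.inl h

theorem comb_neg (b : Fin 3 → E3) (y : Fin 3 → ℝ) : comb (-b) y = -comb b y := by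
  simp [comb_apply]

theorem Admissible.neg {ι : Type*} {u : ι → Fin 3 → ℝ} (hu : Admissible u) : Admissible (-u) := by
  intro i j hij k m h
  refine hu i j hij k (-m) ?_
  simp only [Pi.neg_apply] at h
  push_cast
  linarith

theorem node_neg {ι : Type*} (b : Fin 3 → E3) (u : ι → Fin 3 → ℝ) (i : ι) (z : Fin 3 → ℤ) :
    node (-b) (-u) i z = node b u i (-z) := by
  rw [node, node, comb_neg, ← map_neg (comb b), map_neg latt, Pi.neg_apply, neg_add, neg_neg]

theorem edge_neg {ι : Type*} (b : Fin 3 → E3) (u : ι → Fin 3 → ℝ) (i : ι) (z : Fin 3 → ℤ)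
    (k : Fin 3) : edge (-b) (-u) i z k = edge b u i (-z - Pi.single k 1) k := by
  rw [edge, edge, node_neg, node_neg, Sym2.eq_swap, sub_add_cancel, neg_add']

/-- The isometry of a framed grid may reverse orientation. In odd dimension negation repairs this:
it makes the basis right-handed without changing the net. -/
theorem gridNet_neg {ι : Type*} [Finite ι] (o : ι) {b : Fin 3 → E3} {u : ι → Fin 3 → ℝ}
    (hb : LinearIndependent ℝ b) (hu : Admissible u) (hb' : LinearIndependent ℝ (-b)) :
    gridNet o (-b) (-u) hb' hu.neg = gridNet o b u hb hu := by
  refine colouredNet_ext ?_ ?_ ?_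
  · ext x
    constructor
    · rintro ⟨i, z, rfl⟩
      exact ⟨i, -z, node_neg b u i z⟩
    · rintro ⟨i, z, rfl⟩
      exact ⟨i, -z, by rw [node_neg, neg_neg]⟩
  · ext x
    constructor
    · rintro ⟨i, z, k, rfl⟩
      exact ⟨i, _, k, edge_neg b u i z k⟩
    · rintro ⟨i, z, k, rfl⟩
      exact ⟨i, -z - Pi.single k 1, k, by rw [edge_neg]; congr 1; abel⟩
  · ext x
    constructor
    · rintro ⟨z, rfl⟩
      exact ⟨-z, node_neg b u o z⟩
    · rintro ⟨z, rfl⟩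
      exact ⟨-z, by rw [node_neg, neg_neg]⟩

theorem eq_comb_single (x : E3) :
    x = comb (fun k => EuclideanSpace.single k (1 : ℝ)) (fun k => x k) := by
  ext l
  simp [comb_apply, Pi.single_apply]

theorem similarity_apply (c : ℝ) (Q : E3 ≃ₗᵢ[ℝ] E3) (p x : E3) :
    similarity c Q p x = p + comb (fun k => c • Q (EuclideanSpace.single k (1 : ℝ))) (fun k => x k) := by
  rw [similarity]
  conv_lhs => rw [eq_comb_single x]
  simp only [comb_apply, map_sum, map_smul, Finset.smul_sum, smul_comm c]

theorem rightHanded_single : RightHanded fun k : Fin 3 => EuclideanSpace.single k (1 : ℝ) := by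
  have : (Matrix.of fun i j : Fin 3 => (EuclideanSpace.single i (1 : ℝ) : E3) j) = 1 := by
    ext i j
    simp [Matrix.one_apply, eq_comm]
  rw [RightHanded, this, Matrix.det_one]
  exact one_pos

theorem linearIndependent_similarity {c : ℝ} (hc : 0 < c) (Q : E3 ≃ₗᵢ[ℝ] E3) :
    LinearIndependent ℝ fun k : Fin 3 => c • Q (EuclideanSpace.single k (1 : ℝ)) := by
  have h1 := rightHanded_single.linearIndependent
  have h2 := h1.map' (c • Q.toLinearEquiv.toLinearMap) (by
    rw [LinearMap.ker_eq_bot]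
    intro x y h
    exact Q.injective (smul_right_injective E3 hc.ne' h))
  exact h2

theorem similarity_image_pcuNodes (c : ℝ) (Q : E3 ≃ₗᵢ[ℝ] E3) {ι : Type*} {u : ι → Fin 3 → ℝ}
    {b : Fin 3 → E3} (hb : b = fun k => c • Q (EuclideanSpace.single k (1 : ℝ))) (i : ι) :
    similarity c Q (comb b (u i)) '' pcuNodes = {x | ∃ z, x = node b u i z} := by
  subst hb
  ext x
  constructor
  · rintro ⟨y, hy, rfl⟩
    choose z hz using hy
    refine ⟨z, ?_⟩
    rw [similarity_apply, node, map_add]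
    congr 2
    ext k
    exact hz k
  · rintro ⟨z, rfl⟩
    refine ⟨WithLp.toLp 2 (latt z), fun k => ⟨z k, rfl⟩, ?_⟩
    rw [similarity_apply, node, map_add]

theorem similarity_image_pcuEdges (c : ℝ) (Q : E3 ≃ₗᵢ[ℝ] E3) {ι : Type*} {u : ι → Fin 3 → ℝ}
    {b : Fin 3 → E3} (hb : b = fun k => c • Q (EuclideanSpace.single k (1 : ℝ))) (i : ι) :
    Sym2.map (similarity c Q (comb b (u i))) '' pcuEdges = {e | ∃ z k, e = edge b u i z k} := by
  subst hb
  have key : ∀ (x : E3) (z : Fin 3 → ℤ) (k : Fin 3), (fun l => x l) = latt z →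
      Sym2.map (similarity c Q (comb (fun k => c • Q (EuclideanSpace.single k (1 : ℝ))) (u i)))
        s(x, x + EuclideanSpace.single k (1 : ℝ))
        = edge (fun k => c • Q (EuclideanSpace.single k (1 : ℝ))) u i z k := by
    intro x z k hx
    rw [Sym2.map_mk, edge, node, node, similarity_apply, similarity_apply, hx, ← map_add, ← map_add]
    congr 4
    ext l
    have := congrFun hx l
    rcases eq_or_ne l k with rfl | h
    · simp_all
    · simp_all
  ext e
  constructor
  · rintro ⟨_, ⟨y, hy, k, rfl⟩, rfl⟩
    choose z hz using hy
    exact ⟨z, k, key y z k (funext hz)⟩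
  · rintro ⟨z, k, rfl⟩
    exact ⟨_, ⟨WithLp.toLp 2 (latt z), fun k => ⟨z k, rfl⟩, k, rfl⟩, key _ z k rfl⟩

theorem comb_mem_bodyOf {ι : Type*} (b : Fin 3 → E3) (u : ι → Fin 3 → ℝ) (i : ι) {y : Fin 3 → ℝ}
    (hy : Axial y) : comb b (u i + y) ∈ bodyOf {e | ∃ z k, e = edge b u i z k} := by
  obtain ⟨z, k, s, hs, rfl⟩ := hy.exists_eq
  exact mem_iUnion₂.2 ⟨_, ⟨z, k, rfl⟩, mem_seg_edge.2 ⟨s, hs, rfl⟩⟩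

/-- If the shifts agree modulo 1 in coordinate `k`, some lines of the two components in the other
two directions lie in a common plane and therefore meet. -/
theorem admissible_of_disjoint {ι : Type*} {b : Fin 3 → E3} {u : ι → Fin 3 → ℝ}
    (h : ∀ i j, i ≠ j → Disjoint (bodyOf {e | ∃ z k, e = edge b u i z k})
      (bodyOf {e | ∃ z k, e = edge b u j z k})) : Admissible u := by
  intro i j hij k m hm
  obtain ⟨l, l', hkl, hkl', hll'⟩ : ∃ l l', k ≠ l ∧ k ≠ l' ∧ l ≠ l' := by
    have : ∀ k : Fin 3, ∃ l l', k ≠ l ∧ k ≠ l' ∧ l ≠ l' := by decide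
    exact this k
  let d : Fin 3 → ℝ := u j - u i
  let y : Fin 3 → ℝ := Function.update 0 l (d l)
  let y' : Fin 3 → ℝ := y - d
  have hyA : Axial y := ⟨l, fun r hr => ⟨0, by simp [y, hr]⟩⟩
  have hyA' : Axial y' := by
    refine ⟨l', fun r hr => ?_⟩
    have : r = k ∨ r = l := by omega
    rcases this with rfl | rfl
    · exact ⟨m, by simp [y', y, d, hkl, ← hm]⟩
    · exact ⟨0, by simp [y', y]⟩
  have heq : u i + y = u j + y' := by simp only [y', d]; abel
  exact (h i j hij).le_bot ⟨comb_mem_bodyOf b u i hyA, heq ▸ comb_mem_bodyOf b u j hyA'⟩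

theorem IsFramedGrid.exists_eq_gridNet {n : ℕ} {M : ColouredNet} (hM : IsFramedGrid n M) :
    ∃ (b : Fin 3 → E3) (u : Fin (n + 1) → Fin 3 → ℝ) (hb : RightHanded b) (hu : Admissible u),
      M = gridNet 0 b u hb.linearIndependent hu := by
  obtain ⟨c, Q, p, hc, hN, hE, hdisj, hF⟩ := hM
  obtain ⟨b, hbdef⟩ : ∃ b : Fin 3 → E3, b = fun k => c • Q (EuclideanSpace.single k (1 : ℝ)) :=
    ⟨_, rfl⟩
  have hb : LinearIndependent ℝ b := hbdef ▸ linearIndependent_similarity hc Q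
  choose u hu using fun i => comb_surjective hb (p i)
  obtain rfl : (fun i => comb b (u i)) = p := funext hu
  simp only [similarity_image_pcuNodes c Q hbdef, similarity_image_pcuEdges c Q hbdef] at *
  have hadm : Admissible u := admissible_of_disjoint hdisj
  have hM : M = gridNet 0 b u hb hadm := by
    refine colouredNet_ext ?_ ?_ hF
    · rw [hN]; ext x; simp [gridNet, gridNodes]
    · rw [hE]; ext x; simp [gridNet, gridEdges]
  rcases rightHanded_or_neg hb with h | h
  · exact ⟨b, u, h, hadm, hM⟩
  · exact ⟨-b, -u, h, hadm.neg, by rw [hM, gridNet_neg]⟩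

/-- The standard basis suffices to realize every cell; for a general basis the net is only an affine
image of a grid. -/
theorem isFramedGrid_gridNet {n : ℕ} {u : Fin (n + 1) → Fin 3 → ℝ} (hu : Admissible u) :
    IsFramedGrid n (gridNet 0 _ u rightHanded_single.linearIndependent hu) := by
  obtain ⟨b, hbdef⟩ : ∃ b : Fin 3 → E3, b = fun k => EuclideanSpace.single k (1 : ℝ) := ⟨_, rfl⟩
  have hb : LinearIndependent ℝ b := hbdef ▸ rightHanded_single.linearIndependent
  suffices h : IsFramedGrid n (gridNet 0 b u hb hu) by
    subst hbdef
    exact h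
  have hb' : b = fun k => (1 : ℝ) • (LinearIsometryEquiv.refl ℝ E3)
      (EuclideanSpace.single k (1 : ℝ)) := by simp [hbdef]
  refine ⟨1, LinearIsometryEquiv.refl ℝ E3, fun i => comb b (u i), one_pos, ?_, ?_, ?_, ?_⟩
  · simp only [similarity_image_pcuNodes 1 _ hb']
    ext x; simp [gridNet, gridNodes]
  · simp only [similarity_image_pcuEdges 1 _ hb']
    ext x; simp [gridNet, gridEdges]
  · intro i j hij
    simp only [similarity_image_pcuEdges 1 _ hb']
    rw [Set.disjoint_left]
    intro x hx hx'
    obtain ⟨_, ⟨z, k, rfl⟩, hx⟩ := mem_iUnion₂.1 hx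
    obtain ⟨_, ⟨w, l, rfl⟩, hx'⟩ := mem_iUnion₂.1 hx'
    obtain ⟨s, -, rfl⟩ := mem_seg_edge.1 hx
    obtain ⟨r, -, h⟩ := mem_seg_edge.1 hx'
    exact hij (hu.eq_of_add_eq (axial_latt_add_single z k s) (axial_latt_add_single w l r)
      (comb_injective hb h)).1
  · simp only [similarity_image_pcuNodes 1 _ hb']
    rfl

/-! ### Isotopies of coordinate grids -/

theorem lineMap_node {ι : Type*} (b : Fin 3 → E3) (u : ι → Fin 3 → ℝ) (i : ι) (z : Fin 3 → ℤ)
    (k : Fin 3) (r : ℝ) :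
    AffineMap.lineMap (node b u i z) (node b u i (z + Pi.single k 1)) r
      = comb b (u i + (latt z + Pi.single k r)) := by
  have : (Pi.single k r : Fin 3 → ℝ) = r • Pi.single k 1 := by
    rw [← Pi.single_smul, smul_eq_mul, mul_one]
  rw [AffineMap.lineMap_apply_module', node_add_single, add_sub_cancel_left, ← add_assoc,
    map_add (comb b), node, this, map_smul, comb_single, add_comm]

/-- Every point of the body is carried along with fixed component and fixed axial coordinates, which
admissibility makes unique at each time. -/
theorem isotopic_of_path {ι : Type*} [Finite ι] (o : ι) {b : unitInterval → Fin 3 → E3}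
    (hbc : Continuous b) (hb : ∀ t, RightHanded (b t)) {u : unitInterval → ι → Fin 3 → ℝ}
    (huc : Continuous u) (hu : ∀ t, Admissible (u t)) :
    PeriodicallyIsotopic (gridNet o (b 0) (u 0) (hb 0).linearIndependent (hu 0))
      (gridNet o (b 1) (u 1) (hb 1).linearIndependent (hu 1)) := by
  classical
  -- Off the initial body the value `x` is a mere default.
  let f : unitInterval → E3 → E3 := fun t x =>
    if h : ∃ p : ι × (Fin 3 → ℝ), Axial p.2 ∧ x = comb (b 0) (u 0 p.1 + p.2) then
      comb (b t) (u t h.choose.1 + h.choose.2) else x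
  have inj : ∀ t, ∀ {i j : ι} {y y' : Fin 3 → ℝ}, Axial y → Axial y' →
      comb (b t) (u t i + y) = comb (b t) (u t j + y') → i = j ∧ y = y' :=
    fun t {i j y y'} hy hy' h =>
      (hu t).eq_of_add_eq hy hy' (comb_injective (hb t).linearIndependent h)
  have hf : ∀ t i y, Axial y → f t (comb (b 0) (u 0 i + y)) = comb (b t) (u t i + y) := by
    intro t i y hy
    have h : ∃ p : ι × (Fin 3 → ℝ), Axial p.2 ∧
        comb (b 0) (u 0 i + y) = comb (b 0) (u 0 p.1 + p.2) := ⟨(i, y), hy, rfl⟩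
    obtain ⟨h1, h2⟩ := inj 0 hy h.choose_spec.1 h.choose_spec.2
    simp only [f]
    rw [dif_pos h, show h.choose = (i, y) from Prod.ext h1.symm h2.symm]
  have hnode : ∀ t i z, f t (node (b 0) (u 0) i z) = node (b t) (u t) i z := fun t i z =>
    hf t i _ (axial_latt z)
  refine ⟨fun t => gridNet o (b t) (u t) (hb t).linearIndependent (hu t), b, f, rfl, rfl, hbc,
    fun t => ⟨isPeriodicityBasis_grid (hb t).linearIndependent (u t), hb t⟩, ?_, ?_, ?_, ?_, ?_, ?_⟩
  · intro t
    rw [body_gridNet, body_gridNet]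
    refine ⟨?_, ?_, ?_⟩
    · rintro _ ⟨i, y, hy, rfl⟩
      exact ⟨i, y, hy, hf t i y hy⟩
    · rintro _ ⟨i, y, hy, rfl⟩ _ ⟨j, y', hy', rfl⟩ h
      rw [hf t i y hy, hf t j y' hy'] at h
      obtain ⟨rfl, rfl⟩ := inj t hy hy' h
      rfl
    · rintro _ ⟨i, y, hy, rfl⟩
      exact ⟨_, ⟨i, y, hy, rfl⟩, hf t i y hy⟩
  · rintro t _ ⟨i, z, rfl⟩
    exact ⟨i, z, hnode t i z⟩
  · rintro t _ ⟨i, z, rfl⟩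
    rw [hnode]
    constructor
    · rintro ⟨w, hw⟩
      obtain ⟨rfl, -⟩ := node_injective (hb t).linearIndependent (hu t) hw
      exact ⟨z, rfl⟩
    · rintro ⟨w, hw⟩
      obtain ⟨rfl, -⟩ := node_injective (hb 0).linearIndependent (hu 0) hw
      exact ⟨z, rfl⟩
  · intro x hx
    rw [body_gridNet] at hx
    obtain ⟨i, y, hy, rfl⟩ := hx
    exact hf 0 i y hy
  · rintro _ ⟨i, z, rfl⟩
    refine (continuous_congr fun t => hnode t i z).2 ?_
    simp only [node, comb_apply]
    fun_prop
  · rintro t p q ⟨i, z, k, h⟩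
    have haff : ∀ r : ℝ, f t (AffineMap.lineMap (node (b 0) (u 0) i z)
        (node (b 0) (u 0) i (z + Pi.single k 1)) r)
        = AffineMap.lineMap (node (b t) (u t) i z) (node (b t) (u t) i (z + Pi.single k 1)) r :=
      fun r => by rw [lineMap_node, lineMap_node, hf t i _ (axial_latt_add_single z k r)]
    rcases Sym2.eq_iff.1 h with ⟨rfl, rfl⟩ | ⟨rfl, rfl⟩
    · rw [hnode, hnode]
      exact ⟨⟨i, z, k, rfl⟩, fun r _ => haff r⟩
    · rw [hnode, hnode]
      refine ⟨⟨i, z, k, Sym2.eq_swap⟩, fun r _ => ?_⟩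
      rw [← AffineMap.lineMap_apply_one_sub, haff, AffineMap.lineMap_apply_one_sub]

/-- All coordinate differences of `u` and `v` have the same integer part. -/
def SameCell {ι : Type*} (u v : ι → Fin 3 → ℝ) : Prop :=
  ∀ i j k, ⌊u i k - u j k⌋ = ⌊v i k - v j k⌋

/-- For distinct components, each difference of shifts stays in the same open interval between
consecutive integers, by convexity. -/
theorem SameCell.admissible_segment {ι : Type*} {u v : ι → Fin 3 → ℝ} (h : SameCell u v)
    (hu : Admissible u) (hv : Admissible v) {t : ℝ} (ht : t ∈ Icc (0 : ℝ) 1) :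
    Admissible ((1 - t) • u + t • v) := by
  intro i j hij k m hm
  have hfl : ∀ {w : ι → Fin 3 → ℝ}, Admissible w →
      w i k - w j k ∈ Ioo (⌊w i k - w j k⌋ : ℝ) (⌊w i k - w j k⌋ + 1) := fun {w} hw =>
    ⟨lt_of_le_of_ne (Int.floor_le _) (hw i j hij k _).symm, Int.lt_floor_add_one _⟩
  have h1 := hfl hu
  have h2 := hfl hv
  rw [← h i j k] at h2
  have h3 := convex_Ioo _ _ h1 h2 (sub_nonneg.2 ht.2) ht.1 (by ring)
  have h4 : (1 - t) • (u i k - u j k) + t • (v i k - v j k) = m := by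
    rw [← hm]
    simp only [Pi.add_apply, Pi.smul_apply, smul_eq_mul]
    ring
  rw [h4] at h3
  have h5 : ⌊u i k - u j k⌋ < m := by exact_mod_cast h3.1
  have h6 : m < ⌊u i k - u j k⌋ + 1 := by exact_mod_cast h3.2
  omega

theorem isotopic_of_sameCell {ι : Type*} [Finite ι] (o : ι) {b c : Fin 3 → E3}
    (hb : RightHanded b) (hc : RightHanded c) {u v : ι → Fin 3 → ℝ} (hu : Admissible u)
    (hv : Admissible v) (h : SameCell u v) :
    PeriodicallyIsotopic (gridNet o b u hb.linearIndependent hu)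
      (gridNet o c v hc.linearIndependent hv) := by
  obtain ⟨γ, hγ, h0, h1, hdet⟩ := exists_path_det_pos hb hc
  let β : unitInterval → Fin 3 → E3 := fun t i => WithLp.toLp 2 (γ t i)
  have hβ : Continuous β := by
    refine continuous_pi fun i => (PiLp.continuous_toLp 2 _).comp ?_
    exact (continuous_apply i).comp hγ
  have hβr : ∀ t, RightHanded (β t) := hdet
  let w : unitInterval → ι → Fin 3 → ℝ := fun t => (1 - (t : ℝ)) • u + (t : ℝ) • v
  have hw : Continuous w := by fun_prop
  have key := isotopic_of_path o hβ hβr hw fun t => h.admissible_segment hu hv t.2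
  have e0 : β 0 = b := by ext i j; simp [β, h0]
  have e1 : β 1 = c := by ext i j; simp [β, h1]
  have f0 : w 0 = u := by simp [w]
  have f1 : w 1 = v := by simp [w]
  simpa only [e0, e1, f0, f1] using key

section

/-! ### Equivariance of isotopies -/

/-- The motion `g` of the nodes of a grid during an isotopy through the nets `N t`. -/
structure NodeMotion {ι : Type*} (N : unitInterval → Net)
    (g : unitInterval → ι → (Fin 3 → ℤ) → E3) : Prop where
  continuous : ∀ i z, Continuous fun t => g t i z
  injective : ∀ t {i j z w}, g t i z = g t j w → i = j ∧ z = w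
  edge_mem : ∀ t i z k, s(g t i z, g t i (z + Pi.single k 1)) ∈ (N t).edges
  edge_surj : ∀ t, ∀ d ∈ (N t).edges, ∃ i z k, d = s(g t i z, g t i (z + Pi.single k 1))

variable {ι : Type*} {N : unitInterval → Net} {g : unitInterval → ι → (Fin 3 → ℤ) → E3}

theorem NodeMotion.node_surj (h : NodeMotion N g) (t : unitInterval) {x : E3}
    (hx : x ∈ (N t).nodes) : ∃ i z, x = g t i z := by
  rw [(N t).nodes_eq] at hx
  obtain ⟨e, he, hx⟩ := hx
  obtain ⟨i, z, k, rfl⟩ := h.edge_surj t e he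
  rcases Sym2.mem_iff.1 hx with rfl | rfl
  · exact ⟨_, _, rfl⟩
  · exact ⟨_, _, rfl⟩

theorem NodeMotion.node_mem (h : NodeMotion N g) (t : unitInterval) (i : ι) (z : Fin 3 → ℤ) :
    g t i z ∈ (N t).nodes := by
  rw [(N t).nodes_eq]
  exact ⟨_, h.edge_mem t i z 0, Sym2.mem_mk_left _ _⟩

theorem NodeMotion.disjoint_segment (h : NodeMotion N g) (t : unitInterval) {i j : ι}
    (hij : i ≠ j) (z w : Fin 3 → ℤ) (k l : Fin 3) :
    Disjoint (segment ℝ (g t i z) (g t i (z + Pi.single k 1)))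
      (segment ℝ (g t j w) (g t j (w + Pi.single l 1))) := by
  rw [Set.disjoint_left]
  intro x hx hx'
  have hne : s(g t i z, g t i (z + Pi.single k 1)) ≠ s(g t j w, g t j (w + Pi.single l 1)) := by
    intro he
    rcases Sym2.eq_iff.1 he with ⟨h1, -⟩ | ⟨h1, -⟩
    · exact hij (h.injective t h1).1
    · exact hij (h.injective t h1).1
  obtain ⟨h1, h2⟩ := (N t).noncrossing _ (h.edge_mem t i z k) _ (h.edge_mem t j w l) hne x hx hx'
  rcases Sym2.mem_iff.1 h1 with rfl | rfl <;> rcases Sym2.mem_iff.1 h2 with h2 | h2 <;>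
    exact hij (h.injective t h2).1

/-- Pigeonhole: among the infinitely many nodes on a coordinate line, two lie in the same
translation orbit, so a positive multiple of `b k` is a period. The product over the three axes
gives a common multiple. -/
theorem exists_smul_mem_translations {o : ι} {b : Fin 3 → E3} {u : ι → Fin 3 → ℝ}
    {S : Set (Sym2 E3)} {a : Fin 3 → E3} (ha : IsPeriodicityBasis (gridNodes b u) S a) :
    ∃ M : ℕ, 0 < M ∧ ∀ k, (M : ℝ) • b k ∈ translations a := by
  obtain ⟨F, hF, -, hcov⟩ := ha.nodes_finite
  have key : ∀ k, ∃ m : ℕ, 0 < m ∧ (m : ℤ) • b k ∈ translations a := by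
    intro k
    choose y hy v hv hyv using fun j : ℕ => hcov (node b u o (Pi.single k (j : ℤ))) ⟨o, _, rfl⟩
    have : Finite F := hF
    obtain ⟨j, j', hne, hjj⟩ := Finite.exists_ne_map_eq_of_infinite fun j => (⟨y j, hy j⟩ : F)
    have hjj' : y j = y j' := congrArg Subtype.val hjj
    have hnode : ∀ j : ℕ, node b u o (Pi.single k (j : ℤ)) = node b u o 0 + (j : ℤ) • b k := by
      intro j
      have := node_add b u o 0 (Pi.single k (j : ℤ))
      rw [zero_add] at this
      rw [this, latt_single]
      have h1 : (Pi.single k ((j : ℤ) : ℝ) : Fin 3 → ℝ) = ((j : ℤ) : ℝ) • Pi.single k 1 := by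
        rw [← Pi.single_smul, smul_eq_mul, mul_one]
      rw [h1, map_smul, comb_single, Int.cast_smul_eq_zsmul]
    have hsub : ∀ j j' : ℕ, y j = y j' → j < j' →
        ∃ m : ℕ, 0 < m ∧ (m : ℤ) • b k ∈ translations a := by
      intro j j' hjj hlt
      refine ⟨j' - j, by omega, ?_⟩
      have : ((j' - j : ℕ) : ℤ) • b k = v j' - v j := by
        have e1 := hyv j
        have e2 := hyv j'
        rw [hnode] at e1 e2
        rw [Nat.cast_sub hlt.le, sub_smul]
        have : v j' - v j = (y j' + v j') - (y j + v j) := by rw [hjj]; abel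
        rw [this, ← e1, ← e2]
        abel
      rw [this]
      exact sub_mem (hv j') (hv j)
    rcases lt_or_gt_of_ne hne with hlt | hlt
    · exact hsub j j' hjj' hlt
    · exact hsub j' j hjj'.symm hlt
  choose m hm hmem using key
  refine ⟨∏ k, m k, Finset.prod_pos fun k _ => hm k, fun k => ?_⟩
  have : ((∏ k, m k : ℕ) : ℝ) • b k
      = ((∏ l ∈ Finset.univ.erase k, m l : ℕ) : ℤ) • ((m k : ℤ) • b k) := by
    rw [smul_smul, ← Int.cast_smul_eq_zsmul ℝ, ← Finset.prod_erase_mul _ _ (Finset.mem_univ k)]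
    push_cast
    rfl
  rw [this]
  exact zsmul_mem (hmem k) _

theorem nodeMotion_of_isotopy {b : Fin 3 → E3} {u : ι → Fin 3 → ℝ} [Finite ι] {o : ι}
    (hb : LinearIndependent ℝ b) (hu : Admissible u) {N : unitInterval → ColouredNet}
    {f : unitInterval → E3 → E3}
    (hbij : ∀ t, BijOn (f t) (gridNet o b u hb hu).body (N t).body)
    (hcont : ∀ p ∈ (gridNet o b u hb hu).nodes, Continuous fun t => f t p)
    (haff : ∀ t, ∀ p q : E3, s(p, q) ∈ (gridNet o b u hb hu).edges →
      s(f t p, f t q) ∈ (N t).edges ∧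
      ∀ r ∈ Icc (0 : ℝ) 1,
        f t (AffineMap.lineMap p q r) = AffineMap.lineMap (f t p) (f t q) r) :
    NodeMotion (fun t => (N t).toNet) (fun t i z => f t (node b u i z)) where
  continuous i z := hcont _ ⟨i, z, rfl⟩
  injective t i j z w h := by
    have hmem : ∀ i z, node b u i z ∈ (gridNet o b u hb hu).body := fun i z => by
      rw [body_gridNet]
      exact ⟨i, _, axial_latt z, rfl⟩
    exact node_injective hb hu ((hbij t).injOn (hmem i z) (hmem j w) h)
  edge_mem t i z k := (haff t _ _ ⟨i, z, k, rfl⟩).1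
  edge_surj t d hd := by
    induction d using Sym2.ind with
    | _ x y =>
    have hxy : x ≠ y := fun h => (N t).nondegenerate _ hd (Sym2.mk_isDiag_iff.2 h)
    -- The midpoint of an edge detects it: it lies on the image of some initial edge, and if that
    -- image were another edge, noncrossing would make the midpoint an end point.
    have hmid : midpoint ℝ x y ∈ segment ℝ x y := midpoint_mem_segment x y
    have hbody : midpoint ℝ x y ∈ (N t).body := mem_iUnion₂.2 ⟨_, hd, hmid⟩
    obtain ⟨x₀, hx₀, hfx⟩ := (hbij t).surjOn hbody
    rw [body_gridNet] at hx₀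
    obtain ⟨i, _, hA, rfl⟩ := hx₀
    obtain ⟨z, k, r, hr, rfl⟩ := hA.exists_eq
    refine ⟨i, z, k, ?_⟩
    by_contra hne
    rw [← lineMap_node, (haff t _ _ ⟨i, z, k, rfl⟩).2 r hr] at hfx
    have hseg : midpoint ℝ x y ∈
        segment ℝ (f t (node b u i z)) (f t (node b u i (z + Pi.single k 1))) := by
      rw [segment_eq_image_lineMap]
      exact ⟨r, hr, hfx⟩
    have hend := ((N t).noncrossing _ hd _ (haff t _ _ ⟨i, z, k, rfl⟩).1 hne _ hmid hseg).1
    rcases Sym2.mem_iff.1 hend with h | h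
    · exact hxy ((midpoint_eq_left_iff ℝ).1 h)
    · exact hxy ((midpoint_eq_right_iff ℝ).1 h)

/-- The coordinates of a point with respect to a basis. -/
def coords (b : Fin 3 → E3) (x : E3) : Fin 3 → ℝ :=
  (Matrix.of fun i j : Fin 3 => b j i)⁻¹.mulVec fun i => x i

theorem comb_eq_mulVec (b : Fin 3 → E3) (y : Fin 3 → ℝ) :
    (fun i => comb b y i) = (Matrix.of fun i j : Fin 3 => b j i).mulVec y := by
  ext i
  simp [comb_apply, Matrix.mulVec, dotProduct, mul_comm]

theorem RightHanded.isUnit_det {b : Fin 3 → E3} (hb : RightHanded b) :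
    IsUnit (Matrix.of fun i j : Fin 3 => b j i).det := by
  have : (Matrix.of fun i j : Fin 3 => b j i) = (Matrix.of fun i j : Fin 3 => b i j).transpose := rfl
  rw [this, Matrix.det_transpose]
  exact (ne_of_gt hb).isUnit

theorem coords_comb {b : Fin 3 → E3} (hb : RightHanded b) (y : Fin 3 → ℝ) :
    coords b (comb b y) = y := by
  rw [coords, comb_eq_mulVec, Matrix.mulVec_mulVec, Matrix.nonsing_inv_mul _ hb.isUnit_det,
    Matrix.one_mulVec]

theorem comb_coords {b : Fin 3 → E3} (hb : RightHanded b) (x : E3) : comb b (coords b x) = x := by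
  obtain ⟨y, rfl⟩ := comb_surjective hb.linearIndependent x
  rw [coords_comb hb]

theorem coords_add {b : Fin 3 → E3} (hb : RightHanded b) (x : E3) (y : Fin 3 → ℝ) :
    coords b (x + comb b y) = coords b x + y := by
  obtain ⟨x, rfl⟩ := comb_surjective hb.linearIndependent x
  rw [← map_add, coords_comb hb, coords_comb hb]

theorem continuous_coords {b : unitInterval → Fin 3 → E3} (hbc : Continuous b)
    (hb : ∀ t, RightHanded (b t)) {x : unitInterval → E3} (hx : Continuous x) :
    Continuous fun t => coords (b t) (x t) := by
  have hm : Continuous fun t => (Matrix.of fun i j : Fin 3 => b t j i) := by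
    refine continuous_matrix fun i j => ?_
    simp only [Matrix.of_apply]
    fun_prop
  have hinv : Continuous fun t => (Matrix.of fun i j : Fin 3 => b t j i)⁻¹ := by
    simp only [Matrix.inv_def, Ring.inverse_eq_inv']
    exact (hm.matrix_det.inv₀ fun t => (hb t).isUnit_det.ne_zero).smul hm.matrix_adjugate
  exact hinv.matrix_mulVec (by fun_prop)

/-- If the lattice generated by a multiple of `b` consists of periods, `b` moves along with the
periodicity bases. -/
theorem exists_moving_basis {b : Fin 3 → E3} (hb : RightHanded b) {a : unitInterval → Fin 3 → E3}
    (hac : Continuous a) (ha : ∀ t, RightHanded (a t)) {M : ℕ} (hM : 0 < M)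
    (hMb : ∀ k, (M : ℝ) • b k ∈ translations (a 0)) :
    ∃ β : unitInterval → Fin 3 → E3, Continuous β ∧ β 0 = b ∧ (∀ t, RightHanded (β t)) ∧
      ∀ t k, (M : ℝ) • β t k ∈ translations (a t) := by
  choose T hT using fun k => mem_translations.1 (hMb k)
  have hM' : (M : ℝ) ≠ 0 := by positivity
  let β : unitInterval → Fin 3 → E3 := fun t k => (M : ℝ)⁻¹ • comb (a t) (latt (T k))
  have hβ0 : β 0 = b := by
    ext1 k
    simp only [β]
    rw [← hT, inv_smul_smul₀ hM']
  have hdet : ∀ t, (Matrix.of fun i j : Fin 3 => β t i j).det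
      = (((M : ℝ)⁻¹) ^ 3 * (Matrix.of fun i j : Fin 3 => (T i j : ℝ)).det)
        * (Matrix.of fun i j : Fin 3 => a t i j).det := by
    intro t
    have : (Matrix.of fun i j : Fin 3 => β t i j) = (M : ℝ)⁻¹ •
        ((Matrix.of fun i j : Fin 3 => (T i j : ℝ)) * (Matrix.of fun i j : Fin 3 => a t i j)) := by
      ext i j
      simp [β, comb_apply, Matrix.mul_apply]
    rw [this, Matrix.det_smul, Matrix.det_mul, Fintype.card_fin, mul_assoc]
  -- The ratio of the determinants of `β t` and `a t` does not depend on time, so time 0 decides its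
  -- sign.
  have hpos : 0 < ((M : ℝ)⁻¹) ^ 3 * (Matrix.of fun i j : Fin 3 => (T i j : ℝ)).det := by
    have h0 : 0 < (Matrix.of fun i j : Fin 3 => β 0 i j).det := by rw [hβ0]; exact hb
    rw [hdet] at h0
    exact pos_of_mul_pos_left h0 (le_of_lt (ha 0))
  refine ⟨β, ?_, hβ0, fun t => ?_, fun t k => mem_translations.2 ⟨T k, ?_⟩⟩
  · simp only [β, comb_apply]
    fun_prop
  · rw [RightHanded, hdet]
    exact mul_pos hpos (ha t)
  · simp only [β]
    rw [smul_inv_smul₀ hM']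

theorem comb_latt_smul (b : Fin 3 → E3) (M : ℕ) (z : Fin 3 → ℤ) :
    comb b (latt ((M : ℤ) • z)) = ∑ k, z k • ((M : ℝ) • b k) := by
  rw [comb_apply]
  refine Finset.sum_congr rfl fun k _ => ?_
  rw [← Int.cast_smul_eq_zsmul ℝ (z k), smul_smul, latt_apply]
  congr 1
  simp [mul_comm]

instance locallyConnectedSpace_unitInterval : LocallyConnectedSpace unitInterval :=
  (isQuotientMap_projIcc (h := zero_le_one (α := ℝ))).isCoinducing.locallyConnectedSpace

/-- The translated node is again a node, so at every time it carries some label. The sets of times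
with a given label are closed, disjoint and countable in number, so one of them is the whole
interval, and time 0 tells which. -/
theorem NodeMotion.equivariant [Countable ι] (h : NodeMotion N g) {a β : unitInterval → Fin 3 → E3}
    (ha : ∀ t, IsPeriodicityBasis (N t).nodes (N t).edges (a t)) (hβ : Continuous β) {M : ℕ}
    (hM : ∀ t k, (M : ℝ) • β t k ∈ translations (a t))
    (h0 : ∀ i z w, g 0 i (z + w) = g 0 i z + comb (β 0) (latt w)) (t : unitInterval)
    (i : ι) (z w : Fin 3 → ℤ) :
    g t i (z + (M : ℤ) • w) = g t i z + comb (β t) (latt ((M : ℤ) • w)) := by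
  let F : ι × (Fin 3 → ℤ) → Set unitInterval := fun q =>
    {t | g t q.1 q.2 = g t i z + comb (β t) (latt ((M : ℤ) • w))}
  obtain ⟨q, hq⟩ := exists_eq_univ_of_countable_closed_partition F
    (fun q => by
      refine isClosed_eq (h.continuous _ _) ((h.continuous _ _).add ?_)
      simp only [comb_apply]
      fun_prop)
    (fun q q' hne => by
      rw [Set.disjoint_left]
      intro t ht ht'
      obtain ⟨h1, h2⟩ := h.injective t (ht.trans ht'.symm)
      exact hne (Prod.ext h1 h2))
    (by
      refine eq_univ_of_forall fun t => mem_iUnion.2 ?_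
      have hv : comb (β t) (latt ((M : ℤ) • w)) ∈ translations (a t) := by
        rw [comb_latt_smul]
        exact sum_mem fun k _ => zsmul_mem (hM t k) _
      obtain ⟨j, y, hy⟩ := h.node_surj t ((ha t).nodes_invariant _ hv _ (h.node_mem t i z))
      exact ⟨(j, y), hy.symm⟩)
  have hq0 : (0 : unitInterval) ∈ F q := hq ▸ mem_univ _
  have hqt : t ∈ F q := hq ▸ mem_univ _
  obtain ⟨h1, h2⟩ := h.injective 0 (hq0.trans (h0 i z _).symm)
  rw [← hqt, h1, h2]

end

section

/-! ### Isotopies preserve the cell of the shifts -/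

/-- Only the finitely many residues modulo `M` matter, and for each of them time runs over a compact
interval. -/
theorem exists_bound_of_periodic {H : unitInterval → (Fin 3 → ℤ) → Fin 3 → ℝ}
    (hH : ∀ z, Continuous fun t => H t z) {M : ℕ} (hM : 0 < M)
    (hper : ∀ t z w, H t (z + (M : ℤ) • w) = H t z) : ∃ C, ∀ t z l, |H t z l| ≤ C := by
  have hS : Continuous fun t => ∑ r : Fin 3 → Fin M, ‖H t fun k => ((r k : ℕ) : ℤ)‖ :=
    continuous_finsetSum _ fun r _ => (hH _).norm
  obtain ⟨C, hC⟩ := isCompact_univ.exists_bound_of_continuousOn hS.continuousOn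
  refine ⟨C, fun t z l => ?_⟩
  have hM0 : (0 : ℤ) < M := by exact_mod_cast hM
  have hlt : ∀ k, (z k % M).toNat < M := fun k => by
    have := Int.emod_lt_of_pos (z k) hM0
    omega
  let r : Fin 3 → Fin M := fun k => ⟨(z k % M).toNat, hlt k⟩
  have hz : z = (fun k => ((r k : ℕ) : ℤ)) + (M : ℤ) • fun k => z k / M := by
    ext k
    simp only [Pi.add_apply, Pi.smul_apply, smul_eq_mul, r]
    rw [Int.toNat_of_nonneg (Int.emod_nonneg _ hM0.ne'), Int.emod_add_mul_ediv]
  rw [hz, hper]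
  calc |H t (fun k => ((r k : ℕ) : ℤ)) l| ≤ ‖H t fun k => ((r k : ℕ) : ℤ)‖ := by
        rw [← Real.norm_eq_abs]
        exact norm_le_pi_norm (H t fun k => ((r k : ℕ) : ℤ)) l
    _ ≤ ∑ r : Fin 3 → Fin M, ‖H t fun k => ((r k : ℕ) : ℤ)‖ :=
      Finset.single_le_sum (f := fun r : Fin 3 → Fin M => ‖H t fun k => ((r k : ℕ) : ℤ)‖)
        (fun _ _ => norm_nonneg _) (Finset.mem_univ r)
    _ ≤ C := (le_abs_self _).trans (hC t (mem_univ t))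

variable {ι : Type*} {N : unitInterval → Net} {g : unitInterval → ι → (Fin 3 → ℤ) → E3}

theorem NodeMotion.coords_disjoint (h : NodeMotion N g) {β : unitInterval → Fin 3 → E3}
    (hβr : ∀ t, RightHanded (β t)) (t : unitInterval) {i j : ι} (hij : i ≠ j) (z w : Fin 3 → ℤ)
    (k l : Fin 3) :
    Disjoint (segment ℝ (coords (β t) (g t i z)) (coords (β t) (g t i (z + Pi.single k 1))))
      (segment ℝ (coords (β t) (g t j w)) (coords (β t) (g t j (w + Pi.single l 1)))) := by
  rw [Set.disjoint_left]
  intro x hx hx'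
  refine Set.disjoint_left.1 (h.disjoint_segment t hij z w k l)
    (show comb (β t) x ∈ _ from ?_) ?_
  · have := mem_image_of_mem (comb (β t)).toAffineMap hx
    rwa [image_segment, LinearMap.coe_toAffineMap, comb_coords (hβr t), comb_coords (hβr t)]
      at this
  · have := mem_image_of_mem (comb (β t)).toAffineMap hx'
    rwa [image_segment, LinearMap.coe_toAffineMap, comb_coords (hβr t), comb_coords (hβr t)]
      at this

/-- The line of component `i` along `a` starts below the line of component `j` along `b` at lattice
height `m` in direction `c`. Ending above it would force a crossing. The uniform bound required for
this comes from periodicity. -/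
theorem NodeMotion.sub_le_of_sub_lt (h : NodeMotion N g) {β : unitInterval → Fin 3 → E3}
    (hβ : Continuous β) (hβr : ∀ t, RightHanded (β t)) {M : ℕ} (hM : 0 < M)
    (hper : ∀ t i z w, g t i (z + (M : ℤ) • w) = g t i z + comb (β t) (latt ((M : ℤ) • w)))
    {u v : ι → Fin 3 → ℝ} (h0 : ∀ i z, g 0 i z = node (β 0) u i z)
    (h1 : ∀ i z, g 1 i z = node (β 1) v i z) {i j : ι} (hij : i ≠ j) {c : Fin 3} {m : ℤ}
    (hlt : u i c - u j c < m) : v i c - v j c ≤ m := by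
  by_contra! hgt
  obtain ⟨a, b, hab, hac, hbc⟩ : ∃ a b, a ≠ b ∧ a ≠ c ∧ b ≠ c := by
    have : ∀ c : Fin 3, ∃ a b, a ≠ b ∧ a ≠ c ∧ b ≠ c := by decide
    exact this c
  let G : unitInterval → ι → (Fin 3 → ℤ) → Fin 3 → ℝ := fun t i z => coords (β t) (g t i z)
  have hG : ∀ i z, Continuous fun t => G t i z := fun i z =>
    continuous_coords hβ hβr (h.continuous i z)
  have hG0 : ∀ i z, G 0 i z = u i + latt z := fun i z => by
    simp only [G]
    rw [h0, node, coords_comb (hβr 0)]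
  have hG1 : ∀ i z, G 1 i z = v i + latt z := fun i z => by
    simp only [G]
    rw [h1, node, coords_comb (hβr 1)]
  have hbd : ∀ i, ∃ C, ∀ t z l, |(G t i z - latt z) l| ≤ C := fun i =>
    exists_bound_of_periodic (H := fun t z => G t i z - latt z)
      (fun z => (hG i z).sub continuous_const) hM fun t z w => by
      simp only [G]
      rw [hper, coords_add (hβr t), map_add latt]
      abel
  have hdisj := fun t z w k l => h.coords_disjoint hβr t hij z w k l
  change ∀ t z w k l, Disjoint (segment ℝ (G t i z) (G t i (z + Pi.single k 1)))
    (segment ℝ (G t j w) (G t j (w + Pi.single l 1))) at hdisj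
  clear_value G
  obtain ⟨C₁, hC₁⟩ := hbd i
  obtain ⟨C₂, hC₂⟩ := hbd j
  have bX : ∀ t s l, |G t i (Pi.single a s) l - (Pi.single a s : Fin 3 → ℤ) l| ≤ max C₁ C₂ :=
    fun t s l => (hC₁ t (Pi.single a s) l).trans (le_max_left C₁ C₂)
  have bY : ∀ t s l, |G t j (Pi.single c m + Pi.single b s) l
      - (Pi.single c m + Pi.single b s : Fin 3 → ℤ) l| ≤ max C₁ C₂ :=
    fun t s l => (hC₂ t (Pi.single c m + Pi.single b s) l).trans (le_max_right C₁ C₂)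
  have kX : ∀ s, (Pi.single a s : Fin 3 → ℤ) c = 0 := fun s => Pi.single_eq_of_ne hac.symm _
  have kY : ∀ s, (Pi.single c m + Pi.single b s : Fin 3 → ℤ) c = m := fun s => by
    rw [Pi.add_apply, Pi.single_eq_same, Pi.single_eq_of_ne hbc.symm, add_zero]
  have hmeet := exists_meet_of_exchange hab hac hbc
    (X := fun t s => G t i (Pi.single a s)) (Y := fun t s => G t j (Pi.single c m + Pi.single b s))
    (fun s => hG _ _) (fun s => hG _ _) (C := max C₁ C₂)
    (fun t s => by
      have := bX t s a
      rwa [Pi.single_eq_same] at this)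
    (fun t s => by
      have := bX t s b
      rwa [Pi.single_eq_of_ne hab.symm, Int.cast_zero, sub_zero] at this)
    (fun t s => by
      have := bY t s b
      rwa [Pi.add_apply, Pi.single_eq_same, Pi.single_eq_of_ne hbc, zero_add] at this)
    (fun t s => by
      have := bY t s a
      rwa [Pi.add_apply, Pi.single_eq_of_ne hab, Pi.single_eq_of_ne hac, zero_add,
        Int.cast_zero, sub_zero] at this)
    (x₀ := u i c) (y₀ := u j c + m) (x₁ := v i c) (y₁ := v j c + m)
    (fun s => by rw [hG0, Pi.add_apply, latt_apply, kX, Int.cast_zero, add_zero])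
    (fun s => by rw [hG0, Pi.add_apply, latt_apply, kY])
    (fun s => by rw [hG1, Pi.add_apply, latt_apply, kX, Int.cast_zero, add_zero])
    (fun s => by rw [hG1, Pi.add_apply, latt_apply, kY])
    (by linarith) (by linarith)
  obtain ⟨t, s, r, x, hx, hx'⟩ := hmeet
  refine Set.disjoint_left.1 (hdisj t (Pi.single a s) (Pi.single c m + Pi.single b r) a b) (show x ∈ _ from ?_) ?_
  · rw [← Pi.single_add]
    exact hx
  · rw [add_assoc, ← Pi.single_add]
    exact hx'

/-- The weak inequalities for `(i, j)` and `(j, i)` confine the final difference to the closed unit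
interval of the initial one; admissibility at time 1 excludes its upper end. -/
theorem NodeMotion.sameCell (h : NodeMotion N g) {β : unitInterval → Fin 3 → E3}
    (hβ : Continuous β) (hβr : ∀ t, RightHanded (β t)) {M : ℕ} (hM : 0 < M)
    (hper : ∀ t i z w, g t i (z + (M : ℤ) • w) = g t i z + comb (β t) (latt ((M : ℤ) • w)))
    {u v : ι → Fin 3 → ℝ} (h0 : ∀ i z, g 0 i z = node (β 0) u i z)
    (h1 : ∀ i z, g 1 i z = node (β 1) v i z) (hu : Admissible u) : SameCell u v := by
  have hv : Admissible v := by
    refine admissible_of_disjoint (b := β 1) fun i j hij => ?_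
    rw [Set.disjoint_left]
    intro x hx hx'
    obtain ⟨_, ⟨z, k, rfl⟩, hx⟩ := mem_iUnion₂.1 hx
    obtain ⟨_, ⟨w, l, rfl⟩, hx'⟩ := mem_iUnion₂.1 hx'
    simp only [edge, ← h1] at hx hx'
    exact Set.disjoint_left.1 (h.disjoint_segment 1 hij z w k l) hx hx'
  intro i j k
  rcases eq_or_ne i j with rfl | hij
  · simp
  have hlt := fun m : ℤ => h.sub_le_of_sub_lt hβ hβr hM hper h0 h1 hij (c := k) (m := m)
  have hgt := fun m : ℤ => h.sub_le_of_sub_lt hβ hβr hM hper h0 h1 hij.symm (c := k) (m := m)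
  symm
  rw [Int.floor_eq_iff]
  have f1 := Int.floor_le (u i k - u j k)
  have f2 := Int.lt_floor_add_one (u i k - u j k)
  have f3 : (⌊u i k - u j k⌋ : ℝ) < u i k - u j k := lt_of_le_of_ne f1 (hu i j hij k _).symm
  have a1 := hlt (⌊u i k - u j k⌋ + 1) (by push_cast; exact f2)
  have a2 := hgt (-⌊u i k - u j k⌋) (by push_cast; linarith)
  push_cast at a1 a2
  refine ⟨by linarith, lt_of_le_of_ne a1 ?_⟩
  have := hv i j hij k (⌊u i k - u j k⌋ + 1)
  push_cast at this
  exact this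

/-! ### Graph isomorphisms of grids are affine on components -/

/-- The integer vectors `±e_k`. -/
def IsUnitVec (s : Fin 3 → ℤ) : Prop := ∃ k, s = Pi.single k 1 ∨ s = -Pi.single k 1

theorem IsUnitVec.abs_le {s : Fin 3 → ℤ} (hs : IsUnitVec s) (l : Fin 3) : |s l| ≤ 1 := by
  obtain ⟨k, rfl | rfl⟩ := hs <;> rcases eq_or_ne l k with rfl | h <;> simp [*]

theorem IsUnitVec.eq_single {s : Fin 3 → ℤ} (hs : IsUnitVec s) {l : Fin 3} (h : s l = 1) :
    s = Pi.single l 1 := by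
  obtain ⟨k, rfl | rfl⟩ := hs
  · rcases eq_or_ne l k with rfl | hne
    · rfl
    · simp [hne] at h
  · rcases eq_or_ne l k with rfl | hne
    · simp at h
    · simp [hne] at h

theorem NodeMotion.adj (h : NodeMotion N g) {t : unitInterval} {i j : ι} {z w : Fin 3 → ℤ}
    (he : s(g t i z, g t j w) ∈ (N t).edges) : i = j ∧ IsUnitVec (w - z) := by
  obtain ⟨l, y, k, hd⟩ := h.edge_surj t _ he
  rcases Sym2.eq_iff.1 hd with ⟨h1, h2⟩ | ⟨h1, h2⟩
  · obtain ⟨rfl, rfl⟩ := h.injective t h1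
    obtain ⟨rfl, rfl⟩ := h.injective t h2
    exact ⟨rfl, k, Or.inl (by simp)⟩
  · obtain ⟨rfl, rfl⟩ := h.injective t h1
    obtain ⟨rfl, rfl⟩ := h.injective t h2
    exact ⟨rfl, k, Or.inr (by simp)⟩

theorem NodeMotion.edge_mem_of_isUnitVec (h : NodeMotion N g) (t : unitInterval) (i : ι)
    (z : Fin 3 → ℤ) {s : Fin 3 → ℤ} (hs : IsUnitVec s) :
    s(g t i z, g t i (z + s)) ∈ (N t).edges := by
  obtain ⟨k, rfl | rfl⟩ := hs
  · exact h.edge_mem t i z k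
  · have := h.edge_mem t i (z + -Pi.single k 1) k
    rw [neg_add_cancel_right, Sym2.eq_swap] at this
    exact this

theorem nodeMotion_const [Finite ι] {o : ι} {c : Fin 3 → E3} {v : ι → Fin 3 → ℝ}
    (hc : LinearIndependent ℝ c) (hv : Admissible v) :
    NodeMotion (fun _ => (gridNet o c v hc hv).toNet) (fun _ i z => node c v i z) where
  continuous _ _ := continuous_const
  injective _ _ _ _ _ h := node_injective hc hv h
  edge_mem _ i z k := ⟨i, z, k, rfl⟩
  edge_surj _ _ hd := hd

section endpoint

variable [Finite ι] {o : ι} {c : Fin 3 → E3} {v : ι → Fin 3 → ℝ}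
  (hc : LinearIndependent ℝ c) (hv : Admissible v)

theorem NodeMotion.exists_unit_step (h : NodeMotion N g) (hN : N 1 = (gridNet o c v hc hv).toNet)
    {i l : ι} {z y : Fin 3 → ℤ} (hz : g 1 i z = node c v l y) {a : Fin 3 → ℤ} (ha : IsUnitVec a) :
    ∃ s, IsUnitVec s ∧ g 1 i (z + a) = node c v l (y + s) := by
  have h' := nodeMotion_const (o := o) hc hv
  obtain ⟨l', y', hy'⟩ := h'.node_surj 1 (hN ▸ h.node_mem 1 i (z + a))
  have he := h.edge_mem_of_isUnitVec 1 i z ha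
  rw [hN, hz, hy'] at he
  obtain ⟨rfl, hs⟩ := h'.adj (t := 1) he
  exact ⟨_, hs, by rw [add_sub_cancel, hy']⟩

/-- If the images of two opposite steps were not opposite, their sum would complete a square whose
fourth corner is a second common neighbour of the two images. But two nodes `z ± e_k` have only `z`
as common neighbour. -/
theorem NodeMotion.straight (h : NodeMotion N g) (hN : N 1 = (gridNet o c v hc hv).toNet) (i : ι)
    (z : Fin 3 → ℤ) (k : Fin 3) :
    g 1 i (z + Pi.single k 1) - g 1 i z = g 1 i z - g 1 i (z + -Pi.single k 1) := by
  have h' := nodeMotion_const (o := o) hc hv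
  obtain ⟨l, y, hy⟩ := h'.node_surj 1 (hN ▸ h.node_mem 1 i z)
  obtain ⟨s, hs, hgs⟩ := h.exists_unit_step hc hv hN hy ⟨k, Or.inl rfl⟩
  obtain ⟨r, hr, hgr⟩ := h.exists_unit_step hc hv hN hy ⟨k, Or.inr rfl⟩
  obtain ⟨i', z', hz'⟩ := h.node_surj 1 (x := node c v l (y + s + r))
    (hN ▸ h'.node_mem 1 l (y + s + r))
  have e1 := h'.edge_mem_of_isUnitVec 1 l (y + s) hr
  have e2 := h'.edge_mem_of_isUnitVec 1 l (y + r) hs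
  rw [add_right_comm] at e2
  rw [← hN, hz', ← hgs] at e1
  rw [← hN, hz', ← hgr] at e2
  obtain ⟨rfl, u1⟩ := h.adj e1
  obtain ⟨-, u2⟩ := h.adj e2
  have hzz : z' - (z + -Pi.single k 1) = Pi.single k 1 := by
    refine u2.eq_single ?_
    have b1 := abs_le.1 (u1.abs_le k)
    have b2 := abs_le.1 (u2.abs_le k)
    simp only [Pi.sub_apply, Pi.add_apply, Pi.neg_apply, Pi.single_eq_same] at b1 b2 ⊢
    omega
  have hzz' : z' = z := by
    rw [sub_eq_iff_eq_add] at hzz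
    rw [hzz]; abel
  rw [hzz', hy] at hz'
  have hsr := (node_injective hc hv hz').2
  have hr' : r = -s := by
    rw [add_assoc, add_eq_left] at hsr
    exact eq_neg_of_add_eq_zero_right hsr
  rw [hgs, hgr, hy, node_add, node_add, hr', map_neg latt, map_neg (comb c)]
  abel

/-- By straightness the nodes on a coordinate line form an arithmetic progression, and after `M`
steps periodicity fixes its total displacement as `M • b k`. -/
theorem NodeMotion.step_eq (h : NodeMotion N g) (hN : N 1 = (gridNet o c v hc hv).toNet)
    {b : Fin 3 → E3} {M : ℕ} (hM : 0 < M)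
    (hper : ∀ i z w, g 1 i (z + (M : ℤ) • w) = g 1 i z + comb b (latt ((M : ℤ) • w)))
    (i : ι) (z : Fin 3 → ℤ) (k : Fin 3) : g 1 i (z + Pi.single k 1) = g 1 i z + b k := by
  set d := g 1 i (z + Pi.single k 1) - g 1 i z with hd
  have hstep : ∀ m : ℕ, g 1 i (z + Pi.single k ((m : ℤ) + 1)) - g 1 i (z + Pi.single k (m : ℤ)) = d := by
    intro m
    induction m with
    | zero => simp [hd]
    | succ m ih =>
      have := h.straight hc hv hN i (z + Pi.single k ((m : ℤ) + 1)) k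
      rw [add_assoc, add_assoc, ← Pi.single_add, ← Pi.single_neg, ← Pi.single_add,
        add_neg_cancel_right, ih] at this
      push_cast
      exact this
  have hsum : ∀ m : ℕ, g 1 i (z + Pi.single k (m : ℤ)) = g 1 i z + (m : ℝ) • d := by
    intro m
    induction m with
    | zero => simp
    | succ m ih =>
      have := hstep m
      rw [sub_eq_iff_eq_add] at this
      push_cast
      rw [this, ih, add_smul, one_smul]
      abel
  have hMM := hsum M
  have hsingle : (Pi.single k (M : ℤ) : Fin 3 → ℤ) = (M : ℤ) • Pi.single k 1 := by
    rw [← Pi.single_smul, smul_eq_mul, mul_one]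
  rw [hsingle, hper, comb_latt_smul] at hMM
  have hbd : b k = d := by
    have h1 := add_left_cancel hMM
    rw [Finset.sum_eq_single k (by intro l _ hl; simp [hl]) (by simp)] at h1
    rw [Pi.single_eq_same, one_smul] at h1
    exact smul_right_injective E3 (by positivity : (M : ℝ) ≠ 0) h1
  rw [hbd, hd]
  abel

theorem eq_of_step_invariant {α : Type*} {F : (Fin 3 → ℤ) → α}
    (hF : ∀ z k, F (z + Pi.single k 1) = F z) (z : Fin 3 → ℤ) : F z = F 0 := by
  have h1 : ∀ (k : Fin 3) (m : ℤ) (z : Fin 3 → ℤ), F (z + Pi.single k m) = F z := by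
    intro k m
    induction m using Int.induction_on with
    | zero => simp
    | succ m ih =>
      intro z
      rw [Pi.single_add, ← add_assoc, hF, ih]
    | pred m ih =>
      intro z
      rw [← hF, add_assoc, ← Pi.single_add, sub_add_cancel, ih]
  have h2 : z = 0 + Pi.single 0 (z 0) + Pi.single 1 (z 1) + Pi.single 2 (z 2) := by
    ext k
    fin_cases k <;> simp
  rw [h2, h1, h1, h1]

theorem NodeMotion.affine_endpoint (h : NodeMotion N g)
    (hN : N 1 = (gridNet o c v hc hv).toNet)
    {b : Fin 3 → E3} {M : ℕ} (hM : 0 < M)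
    (hper : ∀ i z w, g 1 i (z + (M : ℤ) • w) = g 1 i z + comb b (latt ((M : ℤ) • w)))
    (i : ι) (z : Fin 3 → ℤ) : g 1 i z = g 1 i 0 + comb b (latt z) := by
  have := eq_of_step_invariant (F := fun z => g 1 i z - comb b (latt z)) (fun z k => by
    rw [h.step_eq hc hv hN hM hper, map_add latt, map_add (comb b), latt_single, Int.cast_one,
      comb_single]
    abel) z
  simp only [map_zero, sub_zero] at this
  rw [← this]
  abel

end endpoint

end

/-! ### Classification of isotopies by their shifts -/

/-- The linear map of an integer matrix. -/
def realMul (B : Matrix (Fin 3) (Fin 3) ℤ) (y : Fin 3 → ℝ) : Fin 3 → ℝ :=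
  (B.map (Int.cast : ℤ → ℝ)).mulVec y

theorem realMul_latt (B : Matrix (Fin 3) (Fin 3) ℤ) (z : Fin 3 → ℤ) :
    realMul B (latt z) = latt (B.mulVec z) := by
  ext k
  simp [realMul, Matrix.mulVec, dotProduct]

theorem realMul_add (B : Matrix (Fin 3) (Fin 3) ℤ) (y y' : Fin 3 → ℝ) :
    realMul B (y + y') = realMul B y + realMul B y' := Matrix.mulVec_add _ _ _

theorem realMul_realMul (B C : Matrix (Fin 3) (Fin 3) ℤ) (y : Fin 3 → ℝ) :
    realMul B (realMul C y) = realMul (B * C) y := by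
  rw [realMul, realMul, realMul, Matrix.mulVec_mulVec]
  congr 1
  exact (Matrix.map_mul (f := Int.castRingHom ℝ)).symm

theorem realMul_one (y : Fin 3 → ℝ) : realMul 1 y = y := by
  rw [realMul, Matrix.map_one _ Int.cast_zero Int.cast_one, Matrix.one_mulVec]

/-- Up to a rotation of the cube, a permutation fixing `o` and integer translations, the shifts `v`
lie in the cell of `u`. -/
def ShiftEquiv {ι : Type*} (o : ι) (u v : ι → Fin 3 → ℝ) : Prop :=
  ∃ B ∈ Matrix.specialOrthogonalGroup (Fin 3) ℤ, ∃ (σ : Equiv.Perm ι) (w : ι → Fin 3 → ℤ)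
    (x : ι → Fin 3 → ℝ), σ o = o ∧ (∀ i, realMul B (x i) = v (σ i) + latt (w i)) ∧ SameCell u x

theorem mem_specialOrthogonalGroup {B : Matrix (Fin 3) (Fin 3) ℤ} :
    B ∈ Matrix.specialOrthogonalGroup (Fin 3) ℤ ↔ B.transpose * B = 1 ∧ B.det = 1 := by
  rw [Matrix.mem_specialOrthogonalGroup_iff, Matrix.mem_orthogonalGroup_iff']

theorem comb_realMul (c : Fin 3 → E3) (B : Matrix (Fin 3) (Fin 3) ℤ) (y : Fin 3 → ℝ) :
    comb (fun k => comb c (latt fun l => B l k)) y = comb c (realMul B y) := by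
  have : realMul B y = ∑ k, y k • latt fun l => B l k := by
    ext l
    simp [realMul, Matrix.mulVec, dotProduct, mul_comm]
  rw [this, map_sum, comb_apply]
  simp only [map_smul]

theorem det_comb_latt (c : Fin 3 → E3) (B : Matrix (Fin 3) (Fin 3) ℤ) :
    (Matrix.of fun i j : Fin 3 => comb c (latt fun l => B l i) j).det
      = (B.det : ℝ) * (Matrix.of fun i j : Fin 3 => c i j).det := by
  have : (Matrix.of fun i j : Fin 3 => comb c (latt fun l => B l i) j)
      = (B.map (Int.castRingHom ℝ)).transpose * Matrix.of fun i j : Fin 3 => c i j := by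
    ext i j
    simp [comb_apply, Matrix.mul_apply]
  rw [this, Matrix.det_mul, Matrix.det_transpose]
  congr 1
  exact (RingHom.map_det _ _).symm

theorem isUnitVec_of_sum_sq {s : Fin 3 → ℤ} (h : ∑ l, s l * s l = 1) : IsUnitVec s := by
  rw [Fin.sum_univ_three] at h
  have h0 : s 0 ≤ 1 ∧ -1 ≤ s 0 := ⟨by nlinarith, by nlinarith⟩
  have h1 : s 1 ≤ 1 ∧ -1 ≤ s 1 := ⟨by nlinarith, by nlinarith⟩
  have h2 : s 2 ≤ 1 ∧ -1 ≤ s 2 := ⟨by nlinarith, by nlinarith⟩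
  have c0 : s 0 = -1 ∨ s 0 = 0 ∨ s 0 = 1 := by omega
  have c1 : s 1 = -1 ∨ s 1 = 0 ∨ s 1 = 1 := by omega
  have c2 : s 2 = -1 ∨ s 2 = 0 ∨ s 2 = 1 := by omega
  have hs : s = ![s 0, s 1, s 2] := by ext k; fin_cases k <;> rfl
  rw [hs]
  have e0 : (Pi.single 0 1 : Fin 3 → ℤ) = ![1, 0, 0] := by ext k; fin_cases k <;> rfl
  have e1 : (Pi.single 1 1 : Fin 3 → ℤ) = ![0, 1, 0] := by ext k; fin_cases k <;> rfl
  have e2 : (Pi.single 2 1 : Fin 3 → ℤ) = ![0, 0, 1] := by ext k; fin_cases k <;> rfl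
  rcases c0 with c0 | c0 | c0 <;> rcases c1 with c1 | c1 | c1 <;> rcases c2 with c2 | c2 | c2 <;>
    rw [c0, c1, c2] at h ⊢ <;> first
    | (exfalso; norm_num at h; done)
    | exact ⟨0, Or.inl e0.symm⟩
    | exact ⟨1, Or.inl e1.symm⟩
    | exact ⟨2, Or.inl e2.symm⟩
    | (refine ⟨0, Or.inr ?_⟩; rw [e0]; simp; done)
    | (refine ⟨1, Or.inr ?_⟩; rw [e1]; simp; done)
    | (refine ⟨2, Or.inr ?_⟩; rw [e2]; simp)

theorem isUnitVec_column {B : Matrix (Fin 3) (Fin 3) ℤ} (hB : B.transpose * B = 1) (k : Fin 3) :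
    IsUnitVec fun l => B l k := by
  apply isUnitVec_of_sum_sq
  have := congrFun (congrFun hB k) k
  simpa [Matrix.mul_apply] using this

theorem IsUnitVec.sum_mul_self {s : Fin 3 → ℤ} (hs : IsUnitVec s) : ∑ l, s l * s l = 1 := by
  obtain ⟨k, rfl | rfl⟩ := hs <;> simp [Pi.single_apply]

theorem IsUnitVec.sum_mul {s r : Fin 3 → ℤ} (hs : IsUnitVec s) (hr : IsUnitVec r) (h1 : s ≠ r)
    (h2 : s ≠ -r) : ∑ l, s l * r l = 0 := by
  obtain ⟨k, rfl | rfl⟩ := hs <;> obtain ⟨m, rfl | rfl⟩ := hr <;>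
    rcases eq_or_ne m k with rfl | hkm <;> simp_all [Pi.single_apply]

theorem shiftEquiv_of_isotopic {ι : Type*} [Finite ι] {o : ι} {b c : Fin 3 → E3}
    (hb : RightHanded b) (hc : RightHanded c) {u v : ι → Fin 3 → ℝ} (hu : Admissible u)
    (hv : Admissible v) (h : PeriodicallyIsotopic (gridNet o b u hb.linearIndependent hu)
      (gridNet o c v hc.linearIndependent hv)) : ShiftEquiv o u v := by
  obtain ⟨N, a, f, hN0, hN1, hac, ha, hbij, -, hframe, hf0, hcont, haff⟩ := h
  have hg := nodeMotion_of_isotopy hb.linearIndependent hu hbij hcont haff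
  obtain ⟨g, hgdef⟩ : ∃ g : unitInterval → ι → (Fin 3 → ℤ) → E3,
    g = fun t i z => f t (node b u i z) := ⟨_, rfl⟩
  rw [← hgdef] at hg
  have hg0 : ∀ i z, g 0 i z = node b u i z := fun i z => by
    rw [hgdef]
    refine hf0 _ ?_
    rw [body_gridNet]
    exact ⟨i, _, axial_latt z, rfl⟩
  have hN1' : (N 1).toNet = (gridNet o c v hc.linearIndependent hv).toNet := by rw [hN1]
  have h' := nodeMotion_const (o := o) hc.linearIndependent hv
  have hper0 : IsPeriodicityBasis (gridNodes b u) (N 0).edges (a 0) := by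
    have := (ha 0).1
    rwa [hN0] at this ⊢
  obtain ⟨M, hM, hMb⟩ := exists_smul_mem_translations (o := o) hper0
  obtain ⟨β, hβ, hβ0, hβr, hMβ⟩ := exists_moving_basis hb hac (fun t => (ha t).2) hM hMb
  have : Countable ι := Finite.to_countable
  have hper := hg.equivariant (fun t => (ha t).1) hβ hMβ
    (fun i z w => by rw [hg0, hg0, hβ0, node_add])
  have hlin := hg.affine_endpoint hc.linearIndependent hv hN1' hM (hper 1)
  let x : ι → Fin 3 → ℝ := fun i => coords (β 1) (g 1 i 0)
  have hg1 : ∀ i z, g 1 i z = node (β 1) x i z := fun i z => by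
    rw [hlin, node, map_add (comb (β 1)), comb_coords (hβr 1)]
  have hcell : SameCell u x :=
    hg.sameCell hβ hβr hM hper (fun i z => by rw [hg0, hβ0]) hg1 hu
  choose σ w hσ using fun i => h'.node_surj 1 (hN1' ▸ hg.node_mem 1 i 0)
  -- The transition matrix is read off at one node of component `o`; it serves all components
  -- because they share the moving basis.
  choose s hs hgs using fun k => hg.exists_unit_step hc.linearIndependent hv hN1' (hσ o)
    ⟨k, Or.inl rfl⟩
  let B : Matrix (Fin 3) (Fin 3) ℤ := Matrix.of fun l k => s k l
  have hβ1 : β 1 = fun k => comb c (latt fun l => B l k) := by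
    ext1 k
    have := hgs k
    rw [hlin, zero_add, latt_single, Int.cast_one, comb_single, node_add, hσ] at this
    exact add_left_cancel this
  have hcomb : ∀ y, comb (β 1) y = comb c (realMul B y) := fun y => by
    rw [hβ1, comb_realMul]
  have hdet : 0 < B.det := by
    have h1 := hβr 1
    rw [RightHanded, hβ1, det_comb_latt] at h1
    exact_mod_cast pos_of_mul_pos_left h1 (le_of_lt hc)
  have hBB : B.transpose * B = 1 := by
    ext k m
    rw [Matrix.mul_apply]
    change ∑ l, s k l * s m l = _
    rcases eq_or_ne k m with rfl | hkm
    · rw [(hs k).sum_mul_self, Matrix.one_apply_eq]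
    · rw [Matrix.one_apply_ne hkm]
      -- Unit vectors are orthogonal unless equal or opposite. Equal columns would annihilate the
      -- determinant, and opposite ones would make `β 1` dependent.
      refine (hs k).sum_mul (hs m) (fun he => ?_) fun he => ?_
      · exact hdet.ne' (Matrix.det_zero_of_column_eq hkm fun l => congrFun he l)
      · have h1 : β 1 k = -β 1 m := by
          rw [hβ1]
          change comb c (latt (s k)) = -comb c (latt (s m))
          rw [he, map_neg latt, map_neg]
        have h2 : comb (β 1) (Pi.single k 1 + Pi.single m 1) = comb (β 1) 0 := by
          rw [map_add, comb_single, comb_single, h1, neg_add_cancel, map_zero]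
        have h3 := congrFun (comb_injective (hβr 1).linearIndependent h2) k
        simp [hkm] at h3
  have hdet1 : B.det = 1 := by
    have := congrArg Matrix.det hBB
    rw [Matrix.det_mul, Matrix.det_transpose, Matrix.det_one] at this
    nlinarith
  have hBB' : B * B.transpose = 1 := mul_eq_one_comm.1 hBB
  have hσinj : Function.Injective σ := by
    intro i j hij
    -- Each component fills its whole final component, since `B` is invertible over the integers; so
    -- two of them cannot land in the same one.
    have h1 : g 1 i 0 = g 1 j (B.transpose.mulVec (w i - w j)) := by
      rw [hlin j, hcomb, realMul_latt, Matrix.mulVec_mulVec, hBB', Matrix.one_mulVec, hσ, hσ,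
        ← hij, ← node_add, add_sub_cancel]
    exact (hg.injective 1 h1).1
  have hσo : σ o = o := by
    have h1 : f 1 (node b u o 0) ∈ (N 1).frame := (hframe 1 _ ⟨o, 0, rfl⟩).2 ⟨0, rfl⟩
    rw [hN1] at h1
    obtain ⟨z, hz⟩ := h1
    have h2 := hσ o
    rw [hgdef] at h2
    exact (node_injective hc.linearIndependent hv (h2.symm.trans hz)).1
  refine ⟨B, mem_specialOrthogonalGroup.2 ⟨hBB, hdet1⟩,
    Equiv.ofBijective σ (Finite.injective_iff_bijective.1 hσinj), w, x, hσo, fun i => ?_, hcell⟩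
  apply comb_injective hc.linearIndependent
  rw [← hcomb, comb_coords (hβr 1), hσ]
  rfl

theorem admissible_of_realMul {ι : Type*} {v x : ι → Fin 3 → ℝ} (hv : Admissible v)
    {B : Matrix (Fin 3) (Fin 3) ℤ} (hBB : B.transpose * B = 1) {σ : Equiv.Perm ι}
    {w : ι → Fin 3 → ℤ} (hx : ∀ i, realMul B (x i) = v (σ i) + latt (w i)) : Admissible x := by
  have hxv : ∀ i, x i = realMul B.transpose (v (σ i) + latt (w i)) := fun i => by
    rw [← hx, realMul_realMul, hBB, realMul_one]
  intro i j hij k m hm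
  have hcol : ∀ y, realMul B.transpose y k = ∑ l, (B l k : ℝ) * y l := fun y => by
    simp [realMul, Matrix.mulVec, dotProduct]
  obtain ⟨l, hl | hl⟩ := isUnitVec_column hBB k
  · have hl' : ∀ y : Fin 3 → ℝ, ∑ l, (B l k : ℝ) * y l = y l := fun y => by
      have : ∀ r, B r k = (Pi.single l 1 : Fin 3 → ℤ) r := fun r => congrFun hl r
      simp [this, Pi.single_apply]
    rw [hxv, hxv, hcol, hcol, hl', hl'] at hm
    refine hv (σ i) (σ j) (σ.injective.ne hij) l (m - w i l + w j l) ?_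
    simp only [Pi.add_apply, latt_apply] at hm
    push_cast
    linarith
  · have hl' : ∀ y : Fin 3 → ℝ, ∑ l, (B l k : ℝ) * y l = -y l := fun y => by
      have : ∀ r, B r k = (-Pi.single l 1 : Fin 3 → ℤ) r := fun r => congrFun hl r
      simp [this, Pi.single_apply]
    rw [hxv, hxv, hcol, hcol, hl', hl'] at hm
    refine hv (σ i) (σ j) (σ.injective.ne hij) l (-m - w i l + w j l) ?_
    simp only [Pi.add_apply, latt_apply] at hm
    push_cast
    linarith

/-- An integral rotation permutes the vectors `±e_k`, so it changes neither lattice nor edges; the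
condition on `σ` preserves the frame. -/
theorem gridNet_reparametrize {ι : Type*} [Finite ι] {o : ι} {c : Fin 3 → E3}
    (hc : RightHanded c) {v : ι → Fin 3 → ℝ} (hv : Admissible v) {B : Matrix (Fin 3) (Fin 3) ℤ}
    (hB : B ∈ Matrix.specialOrthogonalGroup (Fin 3) ℤ) {σ : Equiv.Perm ι} {w : ι → Fin 3 → ℤ}
    {x : ι → Fin 3 → ℝ} (hσ : σ o = o) (hx : ∀ i, realMul B (x i) = v (σ i) + latt (w i)) :
    ∃ (β : Fin 3 → E3) (hβ : RightHanded β) (hx : Admissible x),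
      gridNet o c v hc.linearIndependent hv = gridNet o β x hβ.linearIndependent hx := by
  obtain ⟨hBB, hdet⟩ := mem_specialOrthogonalGroup.1 hB
  have hBB' : B * B.transpose = 1 := mul_eq_one_comm.1 hBB
  let β : Fin 3 → E3 := fun k => comb c (latt fun l => B l k)
  have hβ : RightHanded β := by
    rw [RightHanded, det_comb_latt, hdet, Int.cast_one, one_mul]
    exact hc
  have hxa := admissible_of_realMul hv hBB hx
  have hnode : ∀ i z, node β x i z = node c v (σ i) (w i + B.mulVec z) := fun i z => by
    rw [node, comb_realMul, realMul_add, hx, realMul_latt, node, map_add latt, add_assoc]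
  have hnode' : ∀ j y, node c v j y
      = node β x (σ.symm j) (B.transpose.mulVec (y - w (σ.symm j))) := fun j y => by
    rw [hnode, Matrix.mulVec_mulVec, hBB', Matrix.one_mulVec, Equiv.apply_symm_apply,
      add_sub_cancel]
  refine ⟨β, hβ, hxa, colouredNet_ext ?_ ?_ ?_⟩
  · ext p
    constructor
    · rintro ⟨j, y, rfl⟩
      exact ⟨_, _, hnode' j y⟩
    · rintro ⟨i, z, rfl⟩
      exact ⟨_, _, hnode i z⟩
  · ext e
    constructor
    · rintro ⟨j, y, k, rfl⟩
      have hcol : IsUnitVec (B.transpose.mulVec (Pi.single k 1)) := by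
        have := isUnitVec_column (B := B.transpose) (by rwa [Matrix.transpose_transpose]) k
        convert this using 1
        ext l
        simp
      rw [edge, hnode', hnode', add_sub_right_comm, Matrix.mulVec_add]
      exact (nodeMotion_const (o := o) hβ.linearIndependent hxa).edge_mem_of_isUnitVec 0 _ _ hcol
    · rintro ⟨i, z, k, rfl⟩
      have hcol : IsUnitVec (B.mulVec (Pi.single k 1)) := by
        convert isUnitVec_column hBB k using 1
        ext l
        simp
      rw [edge, hnode, hnode, Matrix.mulVec_add, ← add_assoc]
      exact (nodeMotion_const (o := o) hc.linearIndependent hv).edge_mem_of_isUnitVec 0 _ _ hcol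
  · ext p
    constructor
    · rintro ⟨y, rfl⟩
      have := hnode' o y
      rw [(Equiv.symm_apply_eq σ).2 hσ.symm] at this
      exact ⟨_, this⟩
    · rintro ⟨z, rfl⟩
      exact ⟨_, (hnode o z).trans (by rw [hσ])⟩

theorem isotopic_iff_shiftEquiv {ι : Type*} [Finite ι] {o : ι} {b c : Fin 3 → E3}
    (hb : RightHanded b) (hc : RightHanded c) {u v : ι → Fin 3 → ℝ} (hu : Admissible u)
    (hv : Admissible v) : PeriodicallyIsotopic (gridNet o b u hb.linearIndependent hu)
      (gridNet o c v hc.linearIndependent hv) ↔ ShiftEquiv o u v := by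
  refine ⟨shiftEquiv_of_isotopic hb hc hu hv, ?_⟩
  rintro ⟨B, hB, σ, w, x, hσ, hx, hcell⟩
  obtain ⟨β, hβ, hxa, heq⟩ := gridNet_reparametrize (o := o) hc hv hB hσ hx
  rw [heq]
  exact isotopic_of_sameCell o hb hβ hu hxa hcell

/-! ### Ranks -/

/-- The number of values of `ψ` below `ψ i`. -/
def rank {n : ℕ} (ψ : Fin n → ℝ) (i : Fin n) : Fin n :=
  ⟨(Finset.univ.filter fun j => ψ j < ψ i).card, by
    have h : i ∉ Finset.univ.filter fun j => ψ j < ψ i := by simp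
    simpa using Finset.card_lt_univ_of_notMem h⟩

theorem rank_congr {n : ℕ} {ψ ψ' : Fin n → ℝ} (h : ∀ i j, ψ i < ψ j ↔ ψ' i < ψ' j) :
    rank ψ = rank ψ' := by
  ext i
  simp only [rank, h]

theorem rank_lt_rank {n : ℕ} {ψ : Fin n → ℝ} {i j : Fin n} :
    rank ψ i < rank ψ j ↔ ψ i < ψ j := by
  have key : ∀ {i j}, ψ i < ψ j → rank ψ i < rank ψ j := fun {i j} h => by
    change (Finset.univ.filter fun l => ψ l < ψ i).card < (Finset.univ.filter fun l => ψ l < ψ j).card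
    refine Finset.card_lt_card (Finset.ssubset_iff_of_subset ?_ |>.2 ⟨i, ?_, ?_⟩)
    · intro l hl
      simp only [Finset.mem_filter_univ] at hl ⊢
      exact hl.trans h
    · simpa using h
    · simp
  refine ⟨fun h => ?_, key⟩
  rcases lt_trichotomy (ψ i) (ψ j) with h1 | h1 | h1
  · exact h1
  · have : rank ψ i = rank ψ j := by ext; simp only [rank, h1]
    exact absurd h this.not_lt
  · exact absurd h (key h1).not_gt

theorem rank_injective {n : ℕ} {ψ : Fin n → ℝ} (hψ : Function.Injective ψ) :
    Function.Injective (rank ψ) := by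
  intro i j h
  by_contra hij
  rcases lt_or_gt_of_ne (hψ.ne hij) with h1 | h1
  · exact (rank_lt_rank.2 h1).ne h
  · exact (rank_lt_rank.2 h1).ne' h

theorem rank_comp_perm {n : ℕ} (ψ : Fin n → ℝ) (τ : Equiv.Perm (Fin n)) (i : Fin n) :
    rank (ψ ∘ τ) i = rank ψ (τ i) := by
  ext
  simp only [rank, Function.comp_apply]
  refine Finset.card_equiv τ fun j => by simp

/-- Order reversal turns values below into values above, and injectivity leaves only `i` itself
uncounted. -/
theorem rank_one_sub {n : ℕ} {ψ : Fin n → ℝ} (hψ : Function.Injective ψ) (i : Fin n) :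
    (rank (fun j => 1 - ψ j) i : ℕ) + rank ψ i + 1 = n := by
  have h1 : (Finset.univ.filter fun j => ψ j < ψ i) ∪ (Finset.univ.filter fun j => ψ i < ψ j)
      = Finset.univ.erase i := by
    ext j
    simp only [Finset.mem_union, Finset.mem_filter_univ, Finset.mem_erase, Finset.mem_univ,
      and_true]
    exact lt_or_lt_iff_ne.trans hψ.ne_iff
  have h2 : Disjoint (Finset.univ.filter fun j => ψ j < ψ i)
      (Finset.univ.filter fun j => ψ i < ψ j) :=
    Finset.disjoint_filter.2 fun j _ h => h.not_gt
  have h3 := Finset.card_union_of_disjoint h2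
  rw [h1, Finset.card_erase_of_mem (Finset.mem_univ i), Finset.card_univ, Fintype.card_fin] at h3
  have h4 : (rank (fun j => 1 - ψ j) i : ℕ) = (Finset.univ.filter fun j => ψ i < ψ j).card := by
    simp only [rank, sub_lt_sub_iff_left]
  have h5 : (rank ψ i : ℕ) = (Finset.univ.filter fun j => ψ j < ψ i).card := rfl
  have := i.pos
  omega

theorem rank_strictMono_comp {n : ℕ} {f : Fin n → ℝ} (hf : StrictMono f)
    (π : Equiv.Perm (Fin n)) : rank (f ∘ π) = π := by
  ext i
  rw [rank_comp_perm]
  simp only [rank, hf.lt_iff_lt]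
  have : (Finset.univ.filter fun j => j < π i) = Finset.Iio (π i) := by ext; simp
  rw [this, Fin.card_Iio]

/-! ### The pattern of a framed grid -/

/-- Fractional parts of the `k`-th coordinates relative to the distinguished component. -/
def fracts {n : ℕ} (u : Fin (n + 1) → Fin 3 → ℝ) (k : Fin 3) (i : Fin n) : ℝ :=
  Int.fract (u i.succ k - u 0 k)

theorem fracts_injective {n : ℕ} {u : Fin (n + 1) → Fin 3 → ℝ} (hu : Admissible u) (k : Fin 3) :
    Function.Injective (fracts u k) := by
  intro i j h
  by_contra hij
  obtain ⟨m, hm⟩ := Int.fract_eq_fract.1 h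
  exact hu i.succ j.succ ((Fin.succ_injective n).ne hij) k m (by linarith)

/-- The cell of the component `i` relative to the distinguished component. -/
def cellPoint {n : ℕ} (u : Fin (n + 1) → Fin 3 → ℝ) (i : Fin n) : Fin 3 → Fin n :=
  fun k => rank (fracts u k) i

theorem cellPoint_apply_ne {n : ℕ} {u : Fin (n + 1) → Fin 3 → ℝ} (hu : Admissible u)
    {i j : Fin n} (hij : i ≠ j) (k : Fin 3) : cellPoint u i k ≠ cellPoint u j k :=
  (rank_injective (fracts_injective hu k)).ne hij

theorem cellPoint_injective {n : ℕ} {u : Fin (n + 1) → Fin 3 → ℝ} (hu : Admissible u) :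
    Function.Injective (cellPoint u) := fun i j h => by
  by_contra hij
  exact cellPoint_apply_ne hu hij 0 (congrFun h 0)

/-- The pattern of a framed grid with shifts `u`. -/
def patternOf {n : ℕ} (u : Fin (n + 1) → Fin 3 → ℝ) (hu : Admissible u) : Pattern n :=
  ⟨Finset.univ.image (cellPoint u), by
    rw [Finset.card_image_of_injective _ (cellPoint_injective hu), Finset.card_univ,
      Fintype.card_fin], by
    intro p hp q hq hpq k
    obtain ⟨i, -, rfl⟩ := Finset.mem_image.1 hp
    obtain ⟨j, -, rfl⟩ := Finset.mem_image.1 hq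
    exact cellPoint_apply_ne hu (fun h => hpq (by rw [h])) k⟩

theorem coe_patternOf {n : ℕ} (u : Fin (n + 1) → Fin 3 → ℝ) (hu : Admissible u) :
    ((patternOf u hu).1 : Set (Fin 3 → Fin n)) = range (cellPoint u) := by
  simp [patternOf]

/-- This is the dictionary between cells and orders: given the floors of `a` and `b`, the floor of
`a - b` and the comparison of fractional parts determine each other. -/
theorem floor_sub_eq (a b : ℝ) :
    ⌊a - b⌋ = ⌊a⌋ - ⌊b⌋ + if Int.fract a < Int.fract b then -1 else 0 := by
  have h1 := Int.fract_nonneg a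
  have h2 := Int.fract_lt_one a
  have h3 := Int.fract_nonneg b
  have h4 := Int.fract_lt_one b
  have h5 := Int.floor_add_fract a
  have h6 := Int.floor_add_fract b
  rw [Int.floor_eq_iff]
  split_ifs with h <;> push_cast <;> constructor <;> linarith

theorem fract_lt_fract_iff (a b : ℝ) : Int.fract a < Int.fract b ↔ ⌊a - b⌋ < ⌊a⌋ - ⌊b⌋ := by
  rw [floor_sub_eq]
  split_ifs with h <;> simp [h]

theorem SameCell.cellPoint_eq {n : ℕ} {u v : Fin (n + 1) → Fin 3 → ℝ} (h : SameCell u v) :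
    cellPoint u = cellPoint v := by
  ext1 i
  ext1 k
  refine congrFun (rank_congr fun i j => ?_) i
  rw [fracts, fracts, fracts, fracts, fract_lt_fract_iff, fract_lt_fract_iff,
    sub_sub_sub_cancel_right, sub_sub_sub_cancel_right, h, h, h]

theorem perm_succ {n : ℕ} {σ : Equiv.Perm (Fin (n + 1))} (hσ : σ 0 = 0) :
    ∃ τ : Equiv.Perm (Fin n), ∀ i, σ i.succ = (τ i).succ := by
  refine ⟨(Equiv.Perm.decomposeFin σ).2, fun i => ?_⟩
  have h := Equiv.Perm.decomposeFin.symm_apply_apply σ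
  have h0 : (Equiv.Perm.decomposeFin σ).1 = 0 := by
    have := DFunLike.congr_fun h 0
    rw [← Prod.mk.eta (p := Equiv.Perm.decomposeFin σ),
      Equiv.Perm.decomposeFin_symm_apply_zero, hσ] at this
    exact this
  have := DFunLike.congr_fun h i.succ
  rw [← Prod.mk.eta (p := Equiv.Perm.decomposeFin σ), Equiv.Perm.decomposeFin_symm_apply_succ,
    h0, Equiv.swap_self] at this
  exact this.symm

theorem range_cellPoint_relabel {n : ℕ} (v : Fin (n + 1) → Fin 3 → ℝ)
    {σ : Equiv.Perm (Fin (n + 1))} (hσ : σ 0 = 0) (w : Fin (n + 1) → Fin 3 → ℤ) :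
    range (cellPoint fun i => v (σ i) + latt (w i)) = range (cellPoint v) := by
  obtain ⟨τ, hτ⟩ := perm_succ hσ
  have h : cellPoint (fun i => v (σ i) + latt (w i)) = cellPoint v ∘ τ := by
    ext1 i
    ext1 k
    simp only [Function.comp_apply, cellPoint]
    rw [← rank_comp_perm]
    congr 1
    ext1 j
    simp only [fracts, Function.comp_apply, ← hτ, hσ, Pi.add_apply, latt_apply]
    rw [Int.fract_eq_fract]
    exact ⟨w j.succ k - w 0 k, by push_cast; ring⟩
  rw [h, EquivLike.range_comp]

theorem centred_injective (n : ℕ) : Function.Injective (centred n) := by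
  intro p q h
  ext k
  have := congrFun h k
  simp only [centred] at this
  omega

/-- A row of `B` selects one coordinate up to sign. A minus sign turns fractional parts `φ` into `1
- φ`, hence rank `r` into `n - 1 - r`, which is negation about the centre. No fractional part is 0,
by admissibility. -/
theorem centred_cellPoint_realMul {n : ℕ} {x : Fin (n + 1) → Fin 3 → ℝ} (hx : Admissible x)
    {B : Matrix (Fin 3) (Fin 3) ℤ} (hBB : B.transpose * B = 1) (i : Fin n) :
    centred n (cellPoint (fun i => realMul B (x i)) i) = B.mulVec (centred n (cellPoint x i)) := by
  have hBB' : B * B.transpose = 1 := mul_eq_one_comm.1 hBB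
  ext k
  obtain ⟨l, hl⟩ := isUnitVec_column (B := B.transpose) (by rwa [Matrix.transpose_transpose]) k
  have hreal : ∀ y, realMul B y k = ∑ r, (B k r : ℝ) * y r := fun y => by
    simp [realMul, Matrix.mulVec, dotProduct]
  have hint : ∀ y : Fin 3 → ℤ, B.mulVec y k = ∑ r, B k r * y r := fun y => rfl
  rcases hl with hl | hl
  · have hB : ∀ r, B k r = (Pi.single l 1 : Fin 3 → ℤ) r := fun r => congrFun hl r
    have hfr : fracts (fun i => realMul B (x i)) k = fracts x l := by
      ext j
      simp [fracts, hreal, hB, Pi.single_apply]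
    rw [hint]
    simp [hB, Pi.single_apply, centred, cellPoint, hfr]
  · have hB : ∀ r, B k r = (-Pi.single l 1 : Fin 3 → ℤ) r := fun r => congrFun hl r
    have hfr : fracts (fun i => realMul B (x i)) k = fun j => 1 - fracts x l j := by
      ext j
      simp only [fracts, hreal, hB]
      have hne : Int.fract (x j.succ l - x 0 l) ≠ 0 := fun h0 => by
        obtain ⟨m, hm⟩ := Int.fract_eq_zero_iff.1 h0
        exact hx j.succ 0 (Fin.succ_ne_zero j) l m hm.symm
      rw [← Int.fract_neg hne]
      congr 1
      simp [Pi.single_apply]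
      ring
    have hr := rank_one_sub (fracts_injective hx l) i
    rw [hint]
    simp only [centred, cellPoint, hfr, hB, Pi.neg_apply]
    simp only [Pi.single_apply, neg_mul, ite_mul, one_mul, zero_mul, Finset.sum_neg_distrib,
      Finset.sum_ite_eq', Finset.mem_univ, if_true]
    omega

theorem sameOrbit_of_shiftEquiv {n : ℕ} {u v : Fin (n + 1) → Fin 3 → ℝ} (hu : Admissible u)
    (hv : Admissible v) (h : ShiftEquiv 0 u v) : SameOrbit (patternOf u hu) (patternOf v hv) := by
  obtain ⟨B, hB, σ, w, x, hσ, hx, hcell⟩ := h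
  have hBB := (mem_specialOrthogonalGroup.1 hB).1
  have hxa := admissible_of_realMul hv hBB hx
  refine ⟨B, hB, ?_⟩
  rw [coe_patternOf, coe_patternOf, hcell.cellPoint_eq, ← range_cellPoint_relabel v hσ w,
    ← range_comp, ← range_comp, ← range_comp]
  congr 1
  ext1 i
  simp only [Function.comp_apply, ← centred_cellPoint_realMul hxa hBB, hx]

theorem exists_sameCell_of_range_eq {n : ℕ} {u y : Fin (n + 1) → Fin 3 → ℝ} (hu : Admissible u)
    (hy : Admissible y) (h : range (cellPoint u) = range (cellPoint y)) :
    ∃ (σ : Equiv.Perm (Fin (n + 1))) (w : Fin (n + 1) → Fin 3 → ℤ), σ 0 = 0 ∧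
      SameCell u fun i => y (σ i) + latt (w i) := by
  choose τ hτ using fun i => (h ▸ mem_range_self i : cellPoint u i ∈ range (cellPoint y))
  have hτi : Function.Injective τ := fun i j hij => cellPoint_injective hu (by
    rw [← hτ i, ← hτ j, hij])
  let σ : Equiv.Perm (Fin (n + 1)) := Equiv.Perm.decomposeFin.symm
    (0, Equiv.ofBijective τ (Finite.injective_iff_bijective.1 hτi))
  have hσ0 : σ 0 = 0 := Equiv.Perm.decomposeFin_symm_apply_zero _ _
  have hσ : ∀ i : Fin n, σ i.succ = (τ i).succ := fun i => by
    simp only [σ, Equiv.Perm.decomposeFin_symm_apply_succ, Equiv.swap_self]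
    rfl
  -- Equality of ranges matches components by `σ`; this choice of `w` equalizes the floors relative
  -- to component 0. The remaining floors follow from the order of the fractional parts, which the
  -- ranks determine.
  let w : Fin (n + 1) → Fin 3 → ℤ := fun i k => ⌊u i k - u 0 k⌋ - ⌊y (σ i) k - y 0 k⌋
  have hw0 : ∀ k, w 0 k = 0 := fun k => by simp [w, hσ0]
  let x : Fin (n + 1) → Fin 3 → ℝ := fun i => y (σ i) + latt (w i)
  have hx0 : ∀ i k, x i k - x 0 k = (y (σ i) k - y 0 k) + w i k := fun i k => by
    simp only [x, Pi.add_apply, latt_apply, hw0, hσ0, Int.cast_zero]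
    ring
  have hfl : ∀ i k, ⌊x i k - x 0 k⌋ = ⌊u i k - u 0 k⌋ := fun i k => by
    rw [hx0, Int.floor_add_intCast]
    simp only [w]
    ring
  have hfr : ∀ i k, Int.fract (x i k - x 0 k) = Int.fract (y (σ i) k - y 0 k) := fun i k => by
    rw [hx0, Int.fract_add_intCast]
  have hpos : ∀ {v : Fin (n + 1) → Fin 3 → ℝ}, Admissible v → ∀ (i : Fin n) k,
      0 < Int.fract (v i.succ k - v 0 k) := fun {v} hv i k => by
    refine lt_of_le_of_ne (Int.fract_nonneg _) fun h0 => ?_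
    obtain ⟨m, hm⟩ := Int.fract_eq_zero_iff.1 h0.symm
    exact hv i.succ 0 (Fin.succ_ne_zero i) k m hm.symm
  have hord : ∀ i j k, Int.fract (u i k - u 0 k) < Int.fract (u j k - u 0 k) ↔
      Int.fract (x i k - x 0 k) < Int.fract (x j k - x 0 k) := by
    intro i j k
    rw [hfr, hfr]
    induction i using Fin.cases with
    | zero =>
      rw [hσ0, sub_self, sub_self, Int.fract_zero]
      induction j using Fin.cases with
      | zero => simp [hσ0]
      | succ j => simp only [hσ, hpos hu, hpos hy]
    | succ i =>
      induction j using Fin.cases with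
      | zero =>
        rw [hσ0, sub_self, sub_self, Int.fract_zero]
        exact iff_of_false (Int.fract_nonneg _).not_gt (Int.fract_nonneg _).not_gt
      | succ j =>
        rw [hσ, hσ]
        change fracts u k i < fracts u k j ↔ fracts y k (τ i) < fracts y k (τ j)
        rw [← rank_lt_rank (ψ := fracts u k), ← rank_lt_rank (ψ := fracts y k)]
        change cellPoint u i k < cellPoint u j k ↔ cellPoint y (τ i) k < cellPoint y (τ j) k
        rw [hτ, hτ]
  refine ⟨σ, w, hσ0, fun i j k => ?_⟩
  change _ = ⌊x i k - x j k⌋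
  rw [← sub_sub_sub_cancel_right (u i k) (u j k) (u 0 k),
    ← sub_sub_sub_cancel_right (x i k) (x j k) (x 0 k),
    floor_sub_eq (u i k - u 0 k), floor_sub_eq (x i k - x 0 k), hfl, hfl]
  simp only [hord]

theorem shiftEquiv_of_sameOrbit {n : ℕ} {u v : Fin (n + 1) → Fin 3 → ℝ} (hu : Admissible u)
    (hv : Admissible v) (h : SameOrbit (patternOf u hu) (patternOf v hv)) :
    ShiftEquiv 0 u v := by
  obtain ⟨B, hB, h⟩ := h
  have hBB := (mem_specialOrthogonalGroup.1 hB).1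
  have hBB' : B * B.transpose = 1 := mul_eq_one_comm.1 hBB
  let y : Fin (n + 1) → Fin 3 → ℝ := fun i => realMul B.transpose (v i)
  have hyv : ∀ i, realMul B (y i) = v i := fun i => by
    simp only [y]
    rw [realMul_realMul, hBB', realMul_one]
  have hya : Admissible y := admissible_of_realMul hv hBB (σ := 1) (w := fun _ => 0)
    fun i => by rw [hyv, map_zero, add_zero, Equiv.Perm.one_apply]
  have hrange : range (cellPoint u) = range (cellPoint y) := by
    rw [coe_patternOf, coe_patternOf, ← range_comp, ← range_comp, ← range_comp] at h
    have h1 : centred n ∘ cellPoint v = (fun z => B.mulVec z) ∘ centred n ∘ cellPoint y := by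
      ext1 i
      simp only [Function.comp_apply, ← centred_cellPoint_realMul hya hBB, hyv]
    have hinj : Function.Injective fun z : Fin 3 → ℤ => B.mulVec z := fun z z' hz => by
      have := congrArg B.transpose.mulVec hz
      simpa only [Matrix.mulVec_mulVec, hBB, Matrix.one_mulVec] using this
    rw [h1, range_comp, range_comp, range_comp _ (centred n ∘ cellPoint u),
      range_comp _ (cellPoint u)] at h
    exact ((centred_injective n).image_injective (hinj.image_injective h)).symm
  obtain ⟨σ, w, hσ, hcell⟩ := exists_sameCell_of_range_eq hu hya hrange
  exact ⟨B, hB, σ, fun i => B.mulVec (w i), _, hσ, fun i => by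
    rw [realMul_add, hyv, realMul_latt], hcell⟩

theorem exists_patternOf_eq {n : ℕ} (P : Pattern n) :
    ∃ (u : Fin (n + 1) → Fin 3 → ℝ) (hu : Admissible u), patternOf u hu = P := by
  let e : Fin n ≃ P.1 := (P.1.equivFinOfCardEq P.2.1).symm
  have hne : ∀ {i j}, i ≠ j → ∀ k, (e i).1 k ≠ (e j).1 k := fun {i j} hij k =>
    P.2.2 _ (e i).2 _ (e j).2 (fun h => hij (e.injective (Subtype.ext h))) k
  let π : Fin 3 → Equiv.Perm (Fin n) := fun k =>
    Equiv.ofBijective (fun i => (e i).1 k) (Finite.injective_iff_bijective.1 fun i j h => by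
      by_contra hij
      exact hne hij k h)
  -- Equally spaced points strictly between 0 and 1, so that none coincides modulo 1 with the
  -- distinguished component at 0.
  let f : Fin n → ℝ := fun m => ((m : ℕ) + 1 : ℝ) / (n + 1)
  have hn : (0 : ℝ) < n + 1 := by positivity
  have hf : StrictMono f := fun m m' h => by
    have : ((m : ℕ) : ℝ) < (m' : ℕ) := by exact_mod_cast h
    exact div_lt_div_of_pos_right (by linarith) hn
  have hf0 : ∀ m, 0 < f m := fun m => by positivity
  have hf1 : ∀ m, f m < 1 := fun m => by
    have : ((m : ℕ) : ℝ) < n := by exact_mod_cast m.2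
    exact (div_lt_one hn).2 (by linarith)
  let u : Fin (n + 1) → Fin 3 → ℝ := Fin.cases 0 fun i k => f (π k i)
  have hint : ∀ {a : ℝ} {m : ℤ}, a = m → -1 < a → a < 1 → a = 0 := fun {a m} h h1 h2 => by
    subst h
    have h1' : -1 < m := by exact_mod_cast h1
    have h2' : m < 1 := by exact_mod_cast h2
    rw [show m = 0 by omega, Int.cast_zero]
  have hu : Admissible u := by
    intro i j hij k m hm
    have h1 : ∀ i, 0 ≤ u i k ∧ u i k < 1 := fun i => by
      induction i using Fin.cases with
      | zero => simp [u]
      | succ i => exact ⟨(hf0 _).le, hf1 _⟩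
    have h2 := hint hm (by linarith [(h1 i).1, (h1 j).2]) (by linarith [(h1 i).2, (h1 j).1])
    induction i using Fin.cases with
    | zero =>
      induction j using Fin.cases with
      | zero => exact hij rfl
      | succ j =>
        have : u 0 k - u j.succ k = 0 - f (π k j) := rfl
        linarith [hf0 (π k j)]
    | succ i =>
      induction j using Fin.cases with
      | zero =>
        have : u i.succ k - u 0 k = f (π k i) - 0 := rfl
        linarith [hf0 (π k i)]
      | succ j =>
        have h3 : f (π k i) = f (π k j) := sub_eq_zero.1 h2
        exact hij (congrArg Fin.succ ((π k).injective (hf.injective h3)))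
  have hcell : cellPoint u = fun i => (e i).1 := by
    ext1 i
    ext1 k
    have : fracts u k = f ∘ π k := by
      ext j
      have h1 : u j.succ k - u 0 k = f (π k j) := sub_zero _
      rw [fracts, h1]
      exact Int.fract_eq_self.2 ⟨(hf0 _).le, hf1 _⟩
    rw [cellPoint, this, rank_strictMono_comp hf]
    rfl
  refine ⟨u, hu, Subtype.ext (Finset.coe_injective ?_)⟩
  rw [coe_patternOf, hcell]
  ext p
  constructor
  · rintro ⟨i, rfl⟩
    exact (e i).2
  · intro hp
    exact ⟨e.symm ⟨p, hp⟩, by simp⟩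

/-- Orbits of patterns are a complete invariant of framed grids up to isotopy. -/
theorem exists_pattern_classifying (n : ℕ) : ∃ Φ : FramedGrid n → Pattern n,
    (∀ M M', FramedGrid.Isotopic M M' ↔ SameOrbit (Φ M) (Φ M')) ∧
    ∀ P, ∃ M, SameOrbit (Φ M) P := by
  choose b u hb hu hM using fun M : FramedGrid n => M.2.exists_eq_gridNet
  have hiff : ∀ M M' : FramedGrid n, FramedGrid.Isotopic M M' ↔
      SameOrbit (patternOf (u M) (hu M)) (patternOf (u M') (hu M')) := by
    intro M M'
    rw [FramedGrid.Isotopic, hM M, hM M', isotopic_iff_shiftEquiv (hb M) (hb M')]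
    exact ⟨sameOrbit_of_shiftEquiv _ _, shiftEquiv_of_sameOrbit _ _⟩
  refine ⟨fun M => patternOf (u M) (hu M), hiff, fun P => ?_⟩
  obtain ⟨v, hv, rfl⟩ := exists_patternOf_eq P
  let M : FramedGrid n := ⟨_, isFramedGrid_gridNet hv⟩
  -- The shifts chosen for `M` need not be `v`, but both describe the same net, and its isotopy to
  -- itself relates them.
  refine ⟨M, sameOrbit_of_shiftEquiv _ _
    ((isotopic_iff_shiftEquiv (hb M) rightHanded_single (hu M) hv).1 ?_)⟩
  rw [← hM M]
  exact (isotopic_iff_shiftEquiv rightHanded_single rightHanded_single hv hv).2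
    (shiftEquiv_of_sameOrbit hv hv ((sameOrbit_equivalence n).refl _))

end FramedGrids

end

theorem theorem7p5 (n : ℕ) :
    Equivalence (FramedGrids.FramedGrid.Isotopic (n := n)) ∧
      Nat.card (Quot (FramedGrids.FramedGrid.Isotopic (n := n))) = FramedGrids.rho n := by
  obtain ⟨Φ, hΦ, hsurj⟩ := FramedGrids.exists_pattern_classifying n
  have heq := FramedGrids.sameOrbit_equivalence n
  refine ⟨⟨fun M => (hΦ M M).2 (heq.refl _), fun {M M'} h => (hΦ M' M).2 (heq.symm ((hΦ M M').1 h)),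
    fun {M M' M''} h h' => (hΦ M M'').2 (heq.trans ((hΦ M M').1 h) ((hΦ M' M'').1 h'))⟩, ?_⟩
  let F : Quot (FramedGrids.FramedGrid.Isotopic (n := n)) →
      Quotient (FramedGrids.orbitSetoid n) :=
    Quot.lift (fun M => Quotient.mk _ (Φ M)) fun M M' h => Quotient.sound ((hΦ M M').1 h)
  refine Nat.card_eq_of_bijective F ⟨?_, ?_⟩
  · rintro ⟨M⟩ ⟨M'⟩ h
    exact Quot.sound ((hΦ M M').2 (Quotient.exact h))
  · rintro ⟨P⟩
    obtain ⟨M, hM⟩ := hsurj P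
    exact ⟨Quot.mk _ M, Quotient.sound hM⟩
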